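/- For an integer $n\ge 0$ let $\Pi_n=\mathrm{Mon}\langle a,b,c\mid (ab^ic)^n=1\ (i\ge 1)\rangle$ and let $A=\{a,b,c\}$. The word problem of $\Pi_n$ with respect to $A$ is the language $$\mathrm{WP}_A^{\Pi_n}=\{u\#v^{\mathrm{rev}} \mid u,v\in A^*,\ u=v \text{ in } \Pi_n\},$$ where $\#\notin A$ and $v^{\mathrm{rev}}$ is the reversal of the word $v$. Put $L_n=\{(ab^ic)^n\mid i\ge 1\}\subseteq A^*$. Then: 1. $\mathrm{WP}_A^{\Pi_n}$ is a context-free language if and only if $n\le 2$. 2. $L_n$ is a context-free language if and only if $n\le 2$. 3. $\mathrm{WP}_A^{\Pi_n}\cap (ab^*c)^n\# = L_n\#$. 4. If $n\ge 1$, the group of units $U(\Pi_n)$ is isomorphic to the free product of countably infinitely many cyclic groups of order $n$. -/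

import Mathlib

open scoped Computability

/-- The three-letter alphabet `A = {a, b, c}`. -/
inductive Letter where
  | a
  | b
  | c

/-- The word `(a bⁱ c)ⁿ` in the free monoid on `{a, b, c}`. -/
def powWord (n i : ℕ) : FreeMonoid Letter :=
  (FreeMonoid.of Letter.a * FreeMonoid.of Letter.b ^ i * FreeMonoid.of Letter.c) ^ n

/-- The defining relations `(a bⁱ c)ⁿ = 1`, one for each `i ≥ 1`. -/
def PiRel (n : ℕ) (u v : FreeMonoid Letter) : Prop :=
  ∃ i : ℕ, 1 ≤ i ∧ u = powWord n i ∧ v = 1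

/-- The monoid `Πₙ = Mon⟨a, b, c ∣ (a bⁱ c)ⁿ = 1 (i ≥ 1)⟩`. -/
abbrev PiMonoid (n : ℕ) : Type :=
  PresentedMonoid (PiRel n)

/-- The word problem `{u # vʳᵉᵛ ∣ u, v ∈ A*, u =_M v}` of a monoid `M` with respect to a family
`gen : A → M` of generators. The alphabet is `Option A`: the letter `x ∈ A` is `some x`, and
`none` is the separator `#`. -/
def wordProblem {A M : Type*} [Monoid M] (gen : A → M) : Language (Option A) :=
  {w | ∃ u v : List A, (u.map gen).prod = (v.map gen).prod ∧
    w = u.map some ++ [none] ++ v.reverse.map some}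

/-- The word problem of `Πₙ` with respect to its generators `a, b, c`. -/
def piWordProblem (n : ℕ) : Language (Option Letter) :=
  wordProblem (PresentedMonoid.of (PiRel n))

/-- The language `{(a bⁱ c)ⁿ ∣ i ≥ 1}` over `{a, b, c}`. -/
def powLanguage (n : ℕ) : Language Letter :=
  {w | ∃ i : ℕ, 1 ≤ i ∧ w = FreeMonoid.toList (powWord n i)}

/-- The one-word language `{#}`. -/
def hashLanguage : Language (Option Letter) := {[none]}

/-- The regular language `(a b* c)ⁿ #`. -/
def regularLanguage (n : ℕ) : Language (Option Letter) :=
  (({[some Letter.a]} : Language (Option Letter)) * ({[some Letter.b]} : Language (Option Letter))∗ *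
    ({[some Letter.c]} : Language (Option Letter))) ^ n * hashLanguage

/-!
The monoid `Πₙ` is studied through its actions on stacks. Let `X` be a set with a base point and
with maps `t i`, for `i ≥ 1`, such that `(t i)ⁿ = id`. A stack configuration
`x₀ y₁ x₁ ⋯ yₖ xₖ` alternates elements of `X` with letters; a letter is pushed together with a new
base point on top, except that a `c` completing a block `a bⁱ c` with `i ≥ 1` removes the block and
applies `t i` to the element below it. A block then acts as `t i` on the top element, so `Πₙ` acts
(`stackRun_congr`), without any need for confluence of the rewriting system. Different choices
of `X` give all the information about `Πₙ` that is needed.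

* With `X = ℤ/n`, where `t i` adds `1` for one chosen `i` only, a product of `n` blocks is seen to
  be trivial only if all its exponents agree and are positive (`eq_replicate_of_piEval_blocks`).
  This determines the intersection of the word problem with `(a b* c)ⁿ #`.
* With `X` the free product of cyclic groups of order `n`, acted on by right multiplication with its
  generators, the homomorphism from `X` to the units of `Πₙ` sending generators to blocks is
  injective, as an element of `X` can be read off the stack, and configurations spell the elements of
  `Πₙ`. It is surjective because a letter `c` on the stack can never be removed, so that a
  configuration with such a letter is not right invertible, while one whose topmost letter is `a`
  or `b` is not left invertible (`freeProductToUnits_surjective`).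
* For `n ≤ 2`, there is a set `X` whose elements are spelled by words in such a way that every step
  only appends a letter or deletes a relator. This yields a normal form such that each word
  arises from its normal form `y₁ ⋯ yₖ` by inserting words representing the identity
  (`exists_normalForm`). As the words representing the identity, and their reversals, have a
  context-free grammar, so does the word problem: generate `w₀ y₁ w₁ ⋯ # ⋯ w₁' y₁ w₀'` from the
  outside to the inside.

For `n ≥ 3`, context-freeness fails by pumping down (`ContextFreeGrammar.exists_shrinks`): shortening
`(a bⁱ c)ⁿ` inside a window of length at most `i` leaves the first or the last block unchanged,
whereas in a word `(a bʲ c)ⁿ` all blocks have the same length (`shrink_ne_blocks`).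
-/

/-! ### Context-free grammars as systems of language inclusions -/

namespace ContextFreeGrammar

variable {T : Type*}

/-- The language denoted by a sentential form once each nonterminal `A` is read as the
language `V A`. -/
def formLanguage {N : Type*} (V : N → Language T) : List (Symbol T N) → Language T
  | [] => 1
  | .terminal t :: α => {[t]} * formLanguage V α
  | .nonterminal A :: α => V A * formLanguage V α

theorem formLanguage_append {N : Type*} (V : N → Language T) (α β : List (Symbol T N)) :
    formLanguage V (α ++ β) = formLanguage V α * formLanguage V β := by
  induction α with
  | nil => simp [formLanguage]
  | cons x α ih => cases x <;> simp [formLanguage, ih, mul_assoc]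

theorem mem_formLanguage_terminal {N : Type*} (V : N → Language T) (w : List T) :
    w ∈ formLanguage V (w.map Symbol.terminal) := by
  induction w with
  | nil => simp [formLanguage]
  | cons t w ih => exact Language.append_mem_mul (Set.mem_singleton [t]) ih

/-- The language generated by a grammar from an arbitrary nonterminal. -/
def languageFrom (g : ContextFreeGrammar T) (A : g.NT) : Language T :=
  {w | g.Derives [.nonterminal A] (w.map .terminal)}

theorem derives_of_mem_formLanguage {g : ContextFreeGrammar T} {α : List (Symbol T g.NT)}
    {w : List T} (hw : w ∈ formLanguage g.languageFrom α) : g.Derives α (w.map .terminal) := by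
  induction α generalizing w with
  | nil =>
    rw [formLanguage, Language.mem_one] at hw
    subst hw
    exact .refl _
  | cons x α ih =>
    cases x with
    | terminal t =>
      obtain ⟨_, rfl, v, hv, rfl⟩ := Language.mem_mul.1 hw
      exact (ih hv).append_left [.terminal t]
    | nonterminal A =>
      obtain ⟨u, hu, v, hv, rfl⟩ := Language.mem_mul.1 hw
      rw [List.map_append]
      exact (Derives.append_right hu α).trans ((ih hv).append_left _)

/-- The generated languages satisfy the inclusion attached to every rule. -/
theorem formLanguage_le_languageFrom {g : ContextFreeGrammar T} {r : ContextFreeRule T g.NT}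
    (hr : r ∈ g.rules) : formLanguage g.languageFrom r.output ≤ g.languageFrom r.input :=
  fun _ hw => (Produces.single ⟨r, hr, .input_output⟩).trans (derives_of_mem_formLanguage hw)

theorem mem_formLanguage_of_derives {g : ContextFreeGrammar T} {V : g.NT → Language T}
    (hV : ∀ r ∈ g.rules, formLanguage V r.output ≤ V r.input) {α : List (Symbol T g.NT)}
    {w : List T} (h : g.Derives α (w.map .terminal)) : w ∈ formLanguage V α := by
  induction h using Relation.ReflTransGen.head_induction_on with
  | refl => exact mem_formLanguage_terminal V w
  | head hp _ ih =>
    obtain ⟨r, hr, hrw⟩ := hp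
    obtain ⟨p, q, rfl, rfl⟩ := hrw.exists_parts
    rw [formLanguage_append, formLanguage_append] at ih ⊢
    have hle : formLanguage V p * formLanguage V r.output * formLanguage V q ≤
        formLanguage V p * formLanguage V [.nonterminal r.input] * formLanguage V q := by
      gcongr
      simpa [formLanguage] using hV r hr
    exact hle ih

/-- The generated languages are the least family satisfying the inclusions attached to the
rules. -/
theorem languageFrom_le {g : ContextFreeGrammar T} {V : g.NT → Language T}
    (hV : ∀ r ∈ g.rules, formLanguage V r.output ≤ V r.input) (A : g.NT) :
    g.languageFrom A ≤ V A := fun w hw => by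
  have : w ∈ formLanguage V [.nonterminal A] := mem_formLanguage_of_derives hV hw
  rwa [formLanguage, formLanguage, mul_one] at this

open Classical in
/-- The grammar with a given list of rules. -/
noncomputable def ofRules {N : Type} (A : N) (l : List (ContextFreeRule T N)) :
    ContextFreeGrammar T where
  NT := N
  initial := A
  rules := l.toFinset

theorem mem_rules_ofRules {N : Type} {A : N} {l : List (ContextFreeRule T N)}
    {r : ContextFreeRule T N} : r ∈ (ofRules A l).rules ↔ r ∈ l := by
  classical
  exact List.mem_toFinset

/-! ### Pumping down -/

/-- `g.BoundedParse S α w` says that `w` can be parsed from the sentential form `α` by trees all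
of whose inner labels lie in `S` and are pairwise distinct along every branch. -/
inductive BoundedParse (g : ContextFreeGrammar T) :
    Set g.NT → List (Symbol T g.NT) → List T → Prop
  | nil (S : Set g.NT) : BoundedParse g S [] []
  | terminal {S : Set g.NT} {α : List (Symbol T g.NT)} {w : List T} (t : T)
      (h : BoundedParse g S α w) : BoundedParse g S (.terminal t :: α) (t :: w)
  | nonterminal {S : Set g.NT} {r : ContextFreeRule T g.NT} {α : List (Symbol T g.NT)}
      {u v : List T} (hr : r ∈ g.rules) (hS : r.input ∈ S)
      (hu : BoundedParse g (S \ {r.input}) r.output u) (hv : BoundedParse g S α v) :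
      BoundedParse g S (.nonterminal r.input :: α) (u ++ v)

namespace BoundedParse

variable {g : ContextFreeGrammar T} {S S' : Set g.NT} {α β : List (Symbol T g.NT)} {u v w : List T}

theorem mono (h : BoundedParse g S α w) (hS : S ⊆ S') : BoundedParse g S' α w := by
  induction h generalizing S' with
  | nil => exact .nil _
  | terminal t _ ih => exact .terminal t (ih hS)
  | nonterminal hr hA _ _ ihu ihv =>
    exact .nonterminal hr (hS hA) (ihu (Set.sdiff_subset_sdiff_left hS)) (ihv hS)

theorem derives (h : BoundedParse g S α w) : g.Derives α (w.map .terminal) := by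
  induction h with
  | nil => exact .refl _
  | terminal t _ ih => exact ih.append_left [.terminal t]
  | @nonterminal S r α u v hr hA _ _ ihu ihv =>
    rw [List.map_append]
    have : g.Derives [.nonterminal r.input] (u.map .terminal) :=
      (Produces.single ⟨r, hr, .input_output⟩).trans ihu
    exact (this.append_right α).trans (ihv.append_left _)

theorem append (hu : BoundedParse g S α u) (hv : BoundedParse g S β v) :
    BoundedParse g S (α ++ β) (u ++ v) := by
  induction hu with
  | nil => exact hv
  | terminal t _ ih => exact .terminal t (ih hv)
  | nonterminal hr hA hu _ _ ih =>
    rw [List.append_assoc]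
    exact .nonterminal hr hA hu (ih hv)

/-- With `k` labels available and right-hand sides of length at most `m`, the yield of a
bounded parse has length at most `m ^ k` for each symbol of the sentential form. -/
theorem length_le {m k : ℕ} (hm : 1 ≤ m) (hg : ∀ r ∈ g.rules, r.output.length ≤ m)
    (h : BoundedParse g S α w) (hfin : S.Finite) (hk : S.ncard ≤ k) :
    w.length ≤ α.length * m ^ k := by
  induction h generalizing k with
  | nil => simp
  | terminal t _ ih =>
    have := ih hfin hk
    have := Nat.one_le_pow k m hm
    simp only [List.length_cons, add_mul, one_mul]
    omega
  | @nonterminal S r α u v hr hA _ _ ihu ihv =>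
    have hv := ihv hfin hk
    have hlt := Set.ncard_sdiff_singleton_lt_of_mem hA hfin
    obtain ⟨k, rfl⟩ : ∃ j, k = j + 1 := ⟨k - 1, by omega⟩
    have hu := ihu (k := k) hfin.sdiff (by omega)
    have := Nat.mul_le_mul_right (m ^ k) (hg r hr)
    rw [← pow_succ'] at this
    simp only [List.length_cons, List.length_append, add_mul, one_mul]
    omega

/-- Either a label `A` can be avoided altogether, or the yield has a factor which is itself
the yield of a bounded parse with root `A`. -/
theorem avoid_or_occurs (h : BoundedParse g S α w) (A : g.NT) :
    BoundedParse g (S \ {A}) α w ∨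
      ∃ x y z, w = x ++ y ++ z ∧ BoundedParse g S [.nonterminal A] y := by
  induction h with
  | nil => exact .inl (.nil _)
  | terminal t _ ih =>
    obtain ih | ⟨x, y, z, rfl, h⟩ := ih
    · exact .inl (.terminal t ih)
    · exact .inr ⟨t :: x, y, z, rfl, h⟩
  | @nonterminal S r α u v hr hA hu _ ihu ihv =>
    by_cases hrA : r.input = A
    · refine .inr ⟨[], u, v, rfl, ?_⟩
      have := BoundedParse.nonterminal hr hA hu (.nil _)
      rwa [List.append_nil, hrA] at this
    obtain ihu | ⟨x, y, z, rfl, h⟩ := ihu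
    · obtain ihv | ⟨x, y, z, rfl, h⟩ := ihv
      · refine .inl (.nonterminal hr ⟨hA, hrA⟩ ?_ ihv)
        rwa [sdiff_right_comm]
      · exact .inr ⟨u ++ x, y, z, by simp, h⟩
    · exact .inr ⟨x, y, z ++ v, by simp, h.mono Set.sdiff_subset⟩

end BoundedParse

/-- The sentential form `α` yields a word obtained from `w` by deleting two factors, not both
empty, that lie in a common factor of length at most `p`. -/
def Shrinks (g : ContextFreeGrammar T) (p : ℕ) (α : List (Symbol T g.NT)) (w : List T) : Prop :=
  ∃ u v x y z, w = u ++ v ++ x ++ y ++ z ∧ v ++ y ≠ [] ∧ (v ++ x ++ y).length ≤ p ∧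
    g.Derives α ((u ++ x ++ z).map .terminal)

theorem Shrinks.append_left {g : ContextFreeGrammar T} {p : ℕ} {α β : List (Symbol T g.NT)}
    {w s : List T} (h : g.Shrinks p α w) (hs : g.Derives β (s.map .terminal)) :
    g.Shrinks p (β ++ α) (s ++ w) := by
  obtain ⟨u, v, x, y, z, rfl, hne, hlen, hd⟩ := h
  refine ⟨s ++ u, v, x, y, z, by simp, hne, hlen, ?_⟩
  have := (Derives.append_right hs α).trans (hd.append_left _)
  simpa using this

theorem Shrinks.append_right {g : ContextFreeGrammar T} {p : ℕ} {α β : List (Symbol T g.NT)}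
    {w s : List T} (h : g.Shrinks p α w) (hs : g.Derives β (s.map .terminal)) :
    g.Shrinks p (α ++ β) (w ++ s) := by
  obtain ⟨u, v, x, y, z, rfl, hne, hlen, hd⟩ := h
  refine ⟨u, v, x, y, z ++ s, by simp, hne, hlen, ?_⟩
  have := (hd.append_right β).trans (Derives.append_left hs _)
  simpa using this

/-- For a suitable `p`, every word of a context-free language either has length at most `p` or
can be shortened inside a window of length `p`.

A parse tree without a repeated label on a branch has a short yield. Otherwise a lowest repetition
`A ⊢ v A y` can be cut out; if `v y` is empty, this gives a smaller tree with the same yield. -/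
theorem exists_shrinks (g : ContextFreeGrammar T) :
    ∃ p : ℕ, ∀ w ∈ g.language, w.length ≤ p ∨ ∃ u v x y z, w = u ++ v ++ x ++ y ++ z ∧
      v ++ y ≠ [] ∧ (v ++ x ++ y).length ≤ p ∧ u ++ x ++ z ∈ g.language := by
  set N : Set g.NT := ContextFreeRule.input '' (g.rules : Set (ContextFreeRule T g.NT))
  have hfin : N.Finite := (g.rules.finite_toSet).image _
  set m := g.rules.sup (fun r => r.output.length) + 1 with hm
  have hg : ∀ r ∈ g.rules, r.output.length ≤ m := fun r hr =>
    (Finset.le_sup (f := fun r : ContextFreeRule T g.NT => r.output.length) hr).trans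
      (Nat.le_succ _)
  set p := m * m ^ N.ncard
  have hm1 : 1 ≤ m := by omega
  have hpm : m ^ N.ncard ≤ p := Nat.le_mul_of_pos_left _ hm1
  -- Every generated word either has a bounded parse or can be shortened: by leastness of the
  -- generated languages it is enough that this property is inherited along the rules.
  let V : g.NT → Language T := fun A =>
    {w | g.Derives [.nonterminal A] (w.map .terminal) ∧
      (g.BoundedParse N [.nonterminal A] w ∨ g.Shrinks p [.nonterminal A] w)}
  have hform : ∀ (α : List (Symbol T g.NT)) (w : List T), w ∈ formLanguage V α →
      g.Derives α (w.map .terminal) ∧ (g.BoundedParse N α w ∨ g.Shrinks p α w) := by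
    intro α
    induction α with
    | nil =>
      intro w hw
      rw [formLanguage, Language.mem_one] at hw
      subst hw
      exact ⟨.refl _, .inl (.nil _)⟩
    | cons s α ih =>
      have key : ∀ u v, g.Derives [s] (u.map .terminal) →
          (g.BoundedParse N [s] u ∨ g.Shrinks p [s] u) → v ∈ formLanguage V α →
          g.Derives (s :: α) ((u ++ v).map .terminal) ∧
            (g.BoundedParse N (s :: α) (u ++ v) ∨ g.Shrinks p (s :: α) (u ++ v)) := by
        intro u v hu hu' hv
        obtain ⟨hv, hv'⟩ := ih v hv
        refine ⟨?_, ?_⟩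
        · rw [List.map_append]
          exact (Derives.append_right hu α).trans (hv.append_left _)
        · obtain hu' | hu' := hu'
          · obtain hv' | hv' := hv'
            · exact .inl (hu'.append hv')
            · exact .inr (hv'.append_left hu)
          · exact .inr (hu'.append_right hv)
      intro w hw
      cases s with
      | terminal t =>
        obtain ⟨_, rfl, v, hv, rfl⟩ := Language.mem_mul.1 hw
        exact key [t] v (.refl _) (.inl (.terminal t (.nil _))) hv
      | nonterminal A =>
        obtain ⟨u, hu, v, hv, rfl⟩ := Language.mem_mul.1 hw
        exact key u v hu.1 hu.2 hv
  have hV : ∀ r ∈ g.rules, formLanguage V r.output ≤ V r.input := by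
    intro r hr w hw
    obtain ⟨hd, h⟩ := hform _ _ hw
    have hrN : r.input ∈ N := ⟨r, hr, rfl⟩
    have hd' : g.Derives [.nonterminal r.input] (w.map .terminal) :=
      (Produces.single ⟨r, hr, .input_output⟩).trans hd
    refine ⟨hd', ?_⟩
    obtain h | ⟨u, v, x, y, z, hw, hne, hlen, hx⟩ := h
    · have hlen : w.length ≤ p :=
        (h.length_le hm1 hg hfin le_rfl).trans (Nat.mul_le_mul_right _ (hg r hr))
      obtain h | ⟨v, x, y, rfl, hx⟩ := h.avoid_or_occurs r.input
      · left
        have := BoundedParse.nonterminal hr hrN h (.nil _)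
        rwa [List.append_nil] at this
      -- The root label recurs below: cut out the part between the two occurrences.
      · by_cases hne : v ++ y = []
        · obtain ⟨rfl, rfl⟩ := List.append_eq_nil_iff.1 hne
          left
          simpa using hx
        · exact .inr ⟨[], v, x, y, [], by simp, hne, hlen, by simpa using hx.derives⟩
    · exact .inr ⟨u, v, x, y, z, hw, hne, hlen,
        (Produces.single ⟨r, hr, .input_output⟩).trans hx⟩
  refine ⟨p, fun w hw => ?_⟩
  obtain ⟨-, h | ⟨u, v, x, y, z, h, hne, hlen, hd⟩⟩ := languageFrom_le hV g.initial hw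
  · left
    have := h.length_le hm1 hg hfin le_rfl
    simp only [List.length_singleton, one_mul] at this
    exact this.trans hpm
  · exact .inr ⟨u, v, x, y, z, h, hne, hlen, hd⟩

end ContextFreeGrammar

/-! ### Words in the generators -/

/-- The word `a bⁱ c`. -/
def block (i : ℕ) : List Letter := .a :: (List.replicate i .b ++ [.c])

/-- The word `(a bⁱ¹ c) ⋯ (a bⁱᵏ c)` attached to a list `[i₁, …, iₖ]` of exponents. -/
def blocks (l : List ℕ) : List Letter := (l.map block).flatten

/-- The element of `Πₙ` represented by a word. -/
def piEval (n : ℕ) (w : List Letter) : PiMonoid n := (w.map (PresentedMonoid.of (PiRel n))).prod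

theorem length_block (i : ℕ) : (block i).length = i + 2 := by simp [block]

theorem blocks_append (l m : List ℕ) : blocks (l ++ m) = blocks l ++ blocks m := by
  simp [blocks]

theorem blocks_cons (i : ℕ) (l : List ℕ) : blocks (i :: l) = block i ++ blocks l := by
  simp [blocks]

theorem length_blocks_replicate (n i : ℕ) :
    (blocks (List.replicate n i)).length = n * (i + 2) := by
  simp [blocks, length_block]

theorem toList_powWord (n i : ℕ) :
    FreeMonoid.toList (powWord n i) = blocks (List.replicate n i) := by
  have h : FreeMonoid.of Letter.a * FreeMonoid.of Letter.b ^ i * FreeMonoid.of Letter.c =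
      FreeMonoid.ofList (block i) := by
    have hb : ∀ k, FreeMonoid.of Letter.b ^ k = FreeMonoid.ofList (List.replicate k .b) := by
      intro k
      induction k with
      | zero => rfl
      | succ k ih => rw [pow_succ', ih]; rfl
    rw [hb]
    simp [block, FreeMonoid.ofList_cons, FreeMonoid.ofList_append, mul_assoc]
  induction n with
  | zero => rfl
  | succ n ih =>
    rw [powWord, h] at ih
    rw [powWord, h, pow_succ', FreeMonoid.toList_mul, ih, List.replicate_succ, blocks_cons]
    rfl

theorem mem_powLanguage {n : ℕ} {w : List Letter} :
    w ∈ powLanguage n ↔ ∃ i, 1 ≤ i ∧ w = blocks (List.replicate n i) := by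
  simp only [← toList_powWord]
  rfl

theorem prod_map_block {M : Type*} [Monoid M] (f : Letter → M) (i : ℕ) :
    ((block i).map f).prod = f .a * f .b ^ i * f .c := by
  simp [block, mul_assoc]

theorem prod_map_blocks {M : Type*} [Monoid M] (f : Letter → M) (l : List ℕ) :
    ((blocks l).map f).prod = (l.map fun i => f .a * f .b ^ i * f .c).prod := by
  induction l with
  | nil => rfl
  | cons i l ih => rw [blocks_cons, List.map_append, List.prod_append, ih, prod_map_block]; simp

theorem piEval_append (n : ℕ) (u v : List Letter) :
    piEval n (u ++ v) = piEval n u * piEval n v := by simp [piEval]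

theorem piEval_cons (n : ℕ) (y : Letter) (u : List Letter) :
    piEval n (y :: u) = PresentedMonoid.of (PiRel n) y * piEval n u := by simp [piEval]

theorem piEval_nil (n : ℕ) : piEval n [] = 1 := rfl

theorem piEval_eq_mk (n : ℕ) (w : List Letter) :
    piEval n w = PresentedMonoid.mk (PiRel n) (FreeMonoid.ofList w) := by
  induction w with
  | nil => rfl
  | cons y w ih => rw [piEval_cons, ih, FreeMonoid.ofList_cons, map_mul]; rfl

theorem exists_piEval {n : ℕ} (m : PiMonoid n) : ∃ w, piEval n w = m := by
  obtain ⟨w, rfl⟩ := PresentedMonoid.surjective_mk m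
  exact ⟨FreeMonoid.toList w, piEval_eq_mk n _⟩

/-- The defining relations hold in `Πₙ`. -/
theorem of_relation (n : ℕ) {i : ℕ} (hi : 1 ≤ i) :
    (PresentedMonoid.of (PiRel n) .a * PresentedMonoid.of (PiRel n) .b ^ i *
      PresentedMonoid.of (PiRel n) .c) ^ n = 1 := by
  have h : PresentedMonoid.mk (PiRel n) (powWord n i) = 1 :=
    PresentedMonoid.mk_eq_mk_of_rel ⟨i, hi, rfl, rfl⟩
  rw [powWord, map_pow, map_mul, map_mul, map_pow] at h
  exact h

/-- The homomorphism out of `Πₙ` given by elements satisfying the defining relations. -/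
def piLift {n : ℕ} {M : Type*} [Monoid M] (f : Letter → M)
    (hf : ∀ i, 1 ≤ i → (f .a * f .b ^ i * f .c) ^ n = 1) : PiMonoid n →* M :=
  PresentedMonoid.lift f <| by
    rintro _ _ ⟨i, hi, rfl, rfl⟩
    simpa [powWord] using hf i hi

theorem piLift_piEval {n : ℕ} {M : Type*} [Monoid M] (f : Letter → M)
    (hf : ∀ i, 1 ≤ i → (f .a * f .b ^ i * f .c) ^ n = 1) (w : List Letter) :
    piLift f hf (piEval n w) = (w.map f).prod := by
  induction w with
  | nil => simp [piEval_nil]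
  | cons y w ih => rw [piEval_cons, map_mul, ih, List.map_cons, List.prod_cons]; rfl

/-! ### The stack model -/

/-- Stack configurations. The configuration `(x, [(yₖ, xₖ₋₁), …, (y₁, x₀)])` stands for
`x₀ y₁ x₁ ⋯ yₖ x`, where the `yⱼ` are letters and the elements of `X` stand for products of
blocks `a bⁱ c` with `i ≥ 1`. -/
abbrev StackState (X : Type*) : Type _ := X × List (Letter × X)

section Stack

variable {X : Type*} (e : X) (t : ℕ → X → X)

open Classical in
/-- `closing e 0 l` looks for an opened block `a bⁱ` with `i ≥ 1` at the top of the stack `l`; if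
there is one, it returns `i`, the element below the block, and the rest of the stack. The
first argument counts the letters `b` seen so far. -/
noncomputable def closing : ℕ → List (Letter × X) → Option (ℕ × X × List (Letter × X))
  | i, (.b, x) :: l => if x = e then closing (i + 1) l else none
  | i, (.a, x) :: l => if 1 ≤ i then some (i, x, l) else none
  | _, (.c, _) :: _ => none
  | _, [] => none

open Classical in
/-- Push a letter. When the letter `c` completes a block `a bⁱ c`, the block is removed
from the stack and `t i` is applied to the element below it. -/
noncomputable def stackStep : Letter → StackState X → StackState X
  | .a, s => (e, (.a, s.1) :: s.2)
  | .b, s => (e, (.b, s.1) :: s.2)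
  | .c, s =>
    if s.1 = e then
      match closing e 0 s.2 with
      | some (i, h, l) => (t i h, l)
      | none => (e, (.c, s.1) :: s.2)
    else (e, (.c, s.1) :: s.2)

/-- Push the letters of a word, from left to right. -/
noncomputable def stackRun (s : StackState X) (w : List Letter) : StackState X :=
  w.foldl (fun s y => stackStep e t y s) s

theorem closing_replicate (k i : ℕ) (hi : 1 ≤ k + i) (h : X) (l : List (Letter × X)) :
    closing e k (List.replicate i (.b, e) ++ (.a, h) :: l) = some (k + i, h, l) := by
  induction i generalizing k with
  | zero =>
    rw [add_zero] at hi ⊢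
    exact if_pos hi
  | succ i ih =>
    rw [List.replicate_succ, List.cons_append, closing, if_pos rfl, ih _ (by omega)]
    congr 2
    omega

theorem eq_of_closing_eq_some {k j : ℕ} {h : X} {l l' : List (Letter × X)}
    (H : closing e k l = some (j, h, l')) :
    ∃ i, j = k + i ∧ 1 ≤ j ∧ l = List.replicate i (.b, e) ++ (.a, h) :: l' := by
  induction l generalizing k with
  | nil => simp [closing] at H
  | cons p l ih =>
    obtain ⟨y, x⟩ := p
    cases y with
    | a =>
      rw [closing] at H
      split_ifs at H with hk
      cases H
      exact ⟨0, rfl, hk, rfl⟩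
    | b =>
      rw [closing] at H
      split_ifs at H with hx
      obtain ⟨i, rfl, hi, rfl⟩ := ih H
      exact ⟨i + 1, by omega, hi, by rw [hx]; rfl⟩
    | c => simp [closing] at H

theorem stackStep_c_cases (s : StackState X) :
    (∃ i h l, 1 ≤ i ∧ s = (e, List.replicate i (.b, e) ++ (.a, h) :: l) ∧
      stackStep e t .c s = (t i h, l)) ∨ stackStep e t .c s = (e, (.c, s.1) :: s.2) := by
  obtain ⟨x, l⟩ := s
  by_cases hx : x = e
  · rcases H : closing e 0 l with _ | ⟨j, h, l'⟩
    · right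
      simp [stackStep, H, hx]
    · obtain ⟨i, hj, hj1, rfl⟩ := eq_of_closing_eq_some e H
      rw [zero_add] at hj
      subst hj
      exact .inl ⟨j, h, l', hj1, by rw [hx], by simp [stackStep, H, hx]⟩
  · right
    simp [stackStep, hx]

theorem stackRun_append (s : StackState X) (u v : List Letter) :
    stackRun e t s (u ++ v) = stackRun e t (stackRun e t s u) v := List.foldl_append

theorem stackRun_cons (s : StackState X) (y : Letter) (v : List Letter) :
    stackRun e t s (y :: v) = stackRun e t (stackStep e t y s) v := rfl

theorem stackRun_replicate_b (i : ℕ) (l : List (Letter × X)) :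
    stackRun e t (e, l) (List.replicate i .b) = (e, List.replicate i (.b, e) ++ l) := by
  induction i generalizing l with
  | zero => rfl
  | succ i ih =>
    rw [List.replicate_succ, stackRun_cons, stackStep, ih, List.replicate_succ', List.append_assoc]
    rfl

theorem stackRun_block_eq (s : StackState X) (i : ℕ) :
    stackRun e t s (block i) =
      stackStep e t .c (e, List.replicate i (.b, e) ++ (.a, s.1) :: s.2) := by
  rw [block, stackRun_cons, stackRun_append, stackStep, stackRun_replicate_b]
  rfl

theorem stackRun_block (s : StackState X) {i : ℕ} (hi : 1 ≤ i) :
    stackRun e t s (block i) = (t i s.1, s.2) := by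
  rw [stackRun_block_eq, stackStep, if_pos rfl, closing_replicate e 0 i (by omega)]
  simp

theorem stackRun_block_zero (s : StackState X) :
    stackRun e t s (block 0) = (e, (.c, e) :: (.a, s.1) :: s.2) := by
  rw [stackRun_block_eq, stackStep, if_pos rfl]
  simp [closing]

theorem stackRun_blocks (s : StackState X) {l : List ℕ} (hl : ∀ i ∈ l, 1 ≤ i) :
    stackRun e t s (blocks l) = (l.foldl (fun x i => t i x) s.1, s.2) := by
  induction l generalizing s with
  | nil => rfl
  | cons i l ih =>
    rw [blocks_cons, stackRun_append, stackRun_block e t s (hl i (by simp)),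
      ih _ fun j hj => hl j (by simp [hj])]
    rfl

/-- A letter `c` on the stack is never removed: only letters `a` and `b` are popped. -/
theorem exists_c_mem_stackRun {s : StackState X} (hs : ∃ x, (Letter.c, x) ∈ s.2)
    (w : List Letter) : ∃ x, (Letter.c, x) ∈ (stackRun e t s w).2 := by
  induction w generalizing s with
  | nil => exact hs
  | cons y w ih =>
    rw [stackRun_cons]
    refine ih ?_
    obtain ⟨x, hx⟩ := hs
    cases y with
    | a => exact ⟨x, by simp [stackStep, hx]⟩
    | b => exact ⟨x, by simp [stackStep, hx]⟩
    | c =>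
      obtain ⟨i, h, l, -, rfl, H⟩ | H := stackStep_c_cases e t s
      · rw [H]
        refine ⟨x, ?_⟩
        simpa using hx
      · exact ⟨x, by simp [H, hx]⟩

/-- The stack model is an action of `Πₙ` if every `t i` satisfies `(t i)ⁿ = id`. -/
theorem stackRun_congr {n : ℕ} (ht : ∀ i, 1 ≤ i → ∀ x, (t i)^[n] x = x) (s : StackState X)
    {u v : List Letter} (h : piEval n u = piEval n v) : stackRun e t s u = stackRun e t s v := by
  let f : Letter → (Function.End (StackState X))ᵐᵒᵖ := fun y => .op (stackStep e t y)
  have hf : ∀ w : List Letter, (w.map f).prod = .op fun s => stackRun e t s w := by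
    intro w
    induction w with
    | nil => rfl
    | cons y w ih => rw [List.map_cons, List.prod_cons, ih]; rfl
  have hrel : ∀ i, 1 ≤ i → (f .a * f .b ^ i * f .c) ^ n = 1 := by
    intro i hi
    rw [← prod_map_block f, ← List.prod_replicate]
    have := prod_map_blocks f (List.replicate n i)
    rw [List.map_replicate, ← prod_map_block f] at this
    rw [← this, hf]
    refine MulOpposite.unop_injective (funext fun s => ?_)
    change stackRun e t s _ = s
    rw [stackRun_blocks e t s fun j hj => by rw [List.eq_of_mem_replicate hj]; exact hi]
    suffices ∀ m x, (List.replicate m i).foldl (fun x i => t i x) x = (t i)^[m] x by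
      rw [this, ht i hi]
    intro m x
    induction m generalizing x with
    | zero => rfl
    | succ m ih => rw [List.replicate_succ, List.foldl_cons, ih, Function.iterate_succ_apply]
  have H := congrArg (piLift f hrel) h
  rw [piLift_piEval, piLift_piEval, hf, hf] at H
  exact congrFun (MulOpposite.op_injective H) s

section Value

variable {M : Type*} [Monoid M] (ψ : X → M) (γ : Letter → M)

/-- The product spelled by a stack, for given values of elements of `X` and of letters. -/
def stackVal : List (Letter × X) → M
  | [] => 1
  | (y, x) :: l => stackVal l * ψ x * γ y

/-- The product spelled by a stack configuration. -/
def stateVal (s : StackState X) : M := stackVal ψ γ s.2 * ψ s.1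

theorem stackVal_replicate_append (i : ℕ) (l : List (Letter × X)) :
    stackVal ψ γ (List.replicate i (.b, e) ++ l) = stackVal ψ γ l * (ψ e * γ .b) ^ i := by
  induction i with
  | zero => simp
  | succ i ih =>
    rw [List.replicate_succ, List.cons_append, stackVal, ih, pow_succ]
    simp only [mul_assoc]

theorem stateVal_open_mul (i : ℕ) (h : X) (l : List (Letter × X)) :
    stateVal ψ γ (e, List.replicate i (.b, e) ++ (.a, h) :: l) * γ .c =
      stackVal ψ γ l * (ψ h * (γ .a * ψ e * (γ .b * ψ e) ^ i * γ .c)) := by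
  have : ∀ x y : M, (x * y) ^ i * x = x * (y * x) ^ i := fun x y => by
    induction i with
    | zero => simp
    | succ i ih => rw [pow_succ', mul_assoc, ih, pow_succ']; simp only [mul_assoc]
  rw [stateVal, stackVal_replicate_append, mul_assoc (stackVal ψ γ _), this, stackVal]
  simp only [mul_assoc]

end Value

end Stack

/-! ### Words of the form `(a b* c)ⁿ` equal to the identity -/

noncomputable instance : DecidableEq Letter := Classical.decEq _

theorem piEval_blocks_replicate (n : ℕ) {i : ℕ} (hi : 1 ≤ i) :
    piEval n (blocks (List.replicate n i)) = 1 := by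
  rw [piEval, prod_map_blocks, List.map_replicate, List.prod_replicate, of_relation n hi]

/-- Counting the blocks `a bⁱ c` modulo `n`, for a fixed `i`, is an action of `Πₙ`. So a product of
`n` blocks that is trivial has all its exponents equal. -/
theorem eq_replicate_of_piEval_blocks {n : ℕ} {l : List ℕ} (hl : l.length = n)
    (h : piEval n (blocks l) = 1) : ∃ i, 1 ≤ i ∧ l = List.replicate n i := by
  -- A block `a c` leaves a letter `c` on the stack for good.
  have hpos : ∀ i ∈ l, 1 ≤ i := by
    intro i hi
    by_contra hi0
    obtain rfl : i = 0 := by omega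
    obtain ⟨l₁, l₂, rfl⟩ := List.append_of_mem hi
    have H := stackRun_congr () (fun _ x => x) (n := n) (fun _ _ _ => rfl) ((), [])
      (h.trans (piEval_nil n).symm)
    rw [blocks_append, blocks_cons, stackRun_append, stackRun_append, stackRun_block_zero] at H
    obtain ⟨x, hx⟩ := exists_c_mem_stackRun () (fun _ x => x)
      (s := ((), (Letter.c, ()) :: (.a, _) :: _)) ⟨(), List.mem_cons_self⟩ (blocks l₂)
    rw [H] at hx
    simp [stackRun] at hx
  cases l with
  | nil =>
    subst hl
    exact ⟨1, le_rfl, rfl⟩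
  | cons i₀ l =>
    refine ⟨i₀, hpos i₀ (by simp), ?_⟩
    have hiter : ∀ (m : ℕ) (d x : ZMod n), (fun y => y + d)^[m] x = x + m * d := by
      intro m d x
      induction m generalizing x with
      | zero => simp
      | succ m ih => rw [Function.iterate_succ_apply, ih]; push_cast; ring
    have H := stackRun_congr (0 : ZMod n) (fun i x => x + if i = i₀ then 1 else 0) (n := n)
      (fun i _ x => by rw [hiter]; simp) (0, []) (h.trans (piEval_nil n).symm)
    rw [stackRun_blocks _ _ _ hpos] at H
    have hfold : ∀ (m : List ℕ) (x : ZMod n),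
        m.foldl (fun x i => x + if i = i₀ then 1 else 0) x = x + m.count i₀ := by
      intro m
      induction m with
      | nil => simp
      | cons i m ih =>
        intro x
        rw [List.foldl_cons, ih, List.count_cons]
        by_cases hi : i = i₀
        · simp only [hi, if_true, beq_self_eq_true]
          push_cast
          ring
        · simp [hi]
    have H0 : (((i₀ :: l).count i₀ : ℕ) : ZMod n) = 0 := by
      have := congrArg Prod.fst H
      rw [hfold, zero_add] at this
      exact this
    have hdvd := (ZMod.natCast_eq_zero_iff _ _).1 H0
    have hle := hl ▸ List.count_le_length (l := i₀ :: l) (a := i₀)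
    have hcount : (i₀ :: l).count i₀ = n :=
      le_antisymm hle (Nat.le_of_dvd (by simp) hdvd)
    rw [List.eq_replicate_iff]
    refine ⟨hl, fun j hj => ?_⟩
    exact (List.count_eq_length.1 (hcount.trans hl.symm) j hj).symm

theorem mem_piWordProblem {n : ℕ} {w : List (Option Letter)} :
    w ∈ piWordProblem n ↔ ∃ u v : List Letter, piEval n u = piEval n v ∧
      w = u.map some ++ [none] ++ v.reverse.map some := Iff.rfl

/-- A word containing a separator has a unique decomposition around it. -/
theorem map_some_append_none_inj {α : Type*} {u u' v v' : List α}
    (h : u.map some ++ [none] ++ v.map some = u'.map some ++ [none] ++ v'.map some) :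
    u = u' ∧ v = v' := by
  induction u generalizing u' with
  | nil =>
    cases u' with
    | nil =>
      refine ⟨rfl, List.map_injective_iff.2 (Option.some_injective α) ?_⟩
      simpa using h
    | cons y u' => simp at h
  | cons x u ih =>
    cases u' with
    | nil => simp at h
    | cons y u' =>
      simp only [List.map_cons, List.cons_append, List.cons.injEq, Option.some.injEq] at h
      obtain ⟨rfl, rfl⟩ := ih h.2
      exact ⟨by rw [h.1], rfl⟩

theorem mem_piWordProblem_append_none {n : ℕ} {u : List Letter} :
    u.map some ++ [none] ∈ piWordProblem n ↔ piEval n u = 1 := by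
  rw [mem_piWordProblem]
  constructor
  · rintro ⟨u', v, h, H⟩
    obtain ⟨rfl, hv⟩ := map_some_append_none_inj (u := u) (v := []) ((List.append_nil _).trans H)
    rw [eq_comm, List.reverse_eq_nil_iff] at hv
    rw [h, hv, piEval_nil]
  · intro h
    exact ⟨u, [], h, by simp⟩

theorem mem_regularLanguage {n : ℕ} {w : List (Option Letter)} :
    w ∈ regularLanguage n ↔ ∃ l : List ℕ, l.length = n ∧ w = (blocks l).map some ++ [none] := by
  have hb : ∀ x : List (Option Letter),
      x ∈ ({[some Letter.a]} : Language (Option Letter)) *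
        ({[some Letter.b]} : Language (Option Letter))∗ *
        ({[some Letter.c]} : Language (Option Letter)) ↔ ∃ i, x = (block i).map some := by
    intro x
    constructor
    · rintro ⟨_, ⟨_, rfl, _, ⟨L, rfl, hL⟩, rfl⟩, _, rfl, rfl⟩
      refine ⟨L.length, ?_⟩
      have : L = List.replicate L.length [some Letter.b] := List.eq_replicate_iff.2 ⟨rfl, hL⟩
      rw [this]
      simp [block]
    · rintro ⟨i, rfl⟩
      refine ⟨_, ⟨_, rfl, _, ⟨List.replicate i [some Letter.b], rfl, fun y hy =>
        List.eq_of_mem_replicate hy⟩, rfl⟩, _, rfl, ?_⟩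
      simp [block]
  rw [regularLanguage, Language.mem_mul]
  simp only [Language.mem_pow, hb]
  constructor
  · rintro ⟨_, ⟨S, rfl, hS, hSb⟩, _, rfl, rfl⟩
    choose! f hf using hSb
    refine ⟨S.map f, by simpa using hS, ?_⟩
    have : S = (S.map f).map fun i => (block i).map some := by
      rw [List.map_map]
      exact (List.map_id' S).symm.trans (List.map_congr_left hf)
    conv_lhs => rw [this]
    simp [blocks, List.map_flatten, Function.comp_def]
  · rintro ⟨l, hl, rfl⟩
    refine ⟨_, ⟨l.map fun i => (block i).map some, rfl, by simpa using hl, ?_⟩, _, rfl, ?_⟩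
    · intro y hy
      obtain ⟨i, -, rfl⟩ := List.mem_map.1 hy
      exact ⟨i, rfl⟩
    · simp [blocks, List.map_flatten, Function.comp_def]

theorem piWordProblem_inf_regularLanguage (n : ℕ) :
    piWordProblem n ⊓ regularLanguage n = Language.map some (powLanguage n) * hashLanguage := by
  ext w
  rw [Language.mem_inf, mem_regularLanguage]
  constructor
  · rintro ⟨hw, l, hl, rfl⟩
    obtain ⟨i, hi, rfl⟩ :=
      eq_replicate_of_piEval_blocks hl (mem_piWordProblem_append_none.1 hw)
    exact Language.append_mem_mul ⟨_, mem_powLanguage.2 ⟨i, hi, rfl⟩, rfl⟩ rfl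
  · rintro ⟨_, ⟨u, hu, rfl⟩, _, rfl, rfl⟩
    obtain ⟨i, hi, rfl⟩ := mem_powLanguage.1 hu
    exact ⟨mem_piWordProblem_append_none.2 (piEval_blocks_replicate n hi), _, by simp, rfl⟩

/-! ### Failure of context-freeness for `n ≥ 3` -/

theorem replicate_append_cons_inj {T : Type*} {x y : T} (hxy : x ≠ y) {i j : ℕ} {s s' : List T}
    (h : List.replicate i x ++ y :: s = List.replicate j x ++ y :: s') : i = j := by
  induction i generalizing j with
  | zero =>
    cases j with
    | zero => rfl
    | succ j => simp [List.replicate_succ, hxy.symm] at h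
  | succ i ih =>
    cases j with
    | zero => simp [List.replicate_succ, hxy] at h
    | succ j => rw [ih (by simpa [List.replicate_succ] using h)]

section Shrink

variable {T : Type*} {f : Letter → T} {n i j : ℕ} {s u v x y z : List T}

/-- A window of length at most `i` in `(a bⁱ c)ⁿ`, where `n ≥ 3`, leaves the first or the last
block untouched. -/
theorem block_prefix_or_suffix (hn : 3 ≤ n)
    (hw : (blocks (List.replicate n i)).map f ++ s = u ++ v ++ x ++ y ++ z)
    (hlen : (v ++ x ++ y).length ≤ i) :
    (block i).map f <+: u ∨ (block i).map f ++ s <:+ z := by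
  have hL := congrArg List.length hw
  obtain ⟨m, rfl⟩ : ∃ m, n = m + 3 := ⟨n - 3, by omega⟩
  simp only [List.length_append, List.length_map, length_blocks_replicate, add_mul] at hL hlen
  by_cases hu : i + 2 ≤ u.length
  · left
    refine List.prefix_of_prefix_length_le (l₃ := u ++ v ++ x ++ y ++ z) ?_ ?_ ?_
    · rw [← hw, List.replicate_succ, blocks_cons, List.map_append, List.append_assoc]
      exact List.prefix_append _ _
    · simp only [List.append_assoc]
      exact List.prefix_append _ _
    · rwa [List.length_map, length_block]
  · right
    refine List.suffix_of_suffix_length_le (l₃ := u ++ v ++ x ++ y ++ z) ?_ ?_ ?_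
    · rw [← hw, List.replicate_succ', blocks_append, List.map_append, List.append_assoc]
      simp [blocks]
    · exact List.suffix_append _ _
    · rw [List.length_append, List.length_map, length_block]
      omega

/-- For `n ≥ 3`, deleting something inside a window of length at most `i` never turns
`(a bⁱ c)ⁿ` into a word `(a bʲ c)ⁿ`. -/
theorem shrink_ne_blocks (hf : f.Injective) (hn : 3 ≤ n)
    (hw : (blocks (List.replicate n i)).map f ++ s = u ++ v ++ x ++ y ++ z)
    (hlen : (v ++ x ++ y).length ≤ i) (hne : v ++ y ≠ [])
    (hx : u ++ x ++ z = (blocks (List.replicate n j)).map f ++ s) : False := by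
  have hij : i = j := by
    obtain ⟨m, rfl⟩ : ∃ m, n = m + 1 := ⟨n - 1, by omega⟩
    obtain ⟨r, rfl⟩ | ⟨r, rfl⟩ := block_prefix_or_suffix hn hw hlen
    · rw [List.replicate_succ, blocks_cons] at hx
      refine replicate_append_cons_inj (x := f .b) (y := f .c) (fun h => nomatch hf h)
        (s := r ++ x ++ z) (s' := (blocks (List.replicate m j)).map f ++ s) ?_
      simpa [block] using hx
    · rw [List.replicate_succ', blocks_append] at hx
      have hx' := congrArg List.reverse hx
      refine replicate_append_cons_inj (x := f .b) (y := f .a) (fun h => nomatch hf h)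
        (s := r.reverse ++ x.reverse ++ u.reverse)
        (s' := ((blocks (List.replicate m j)).map f).reverse) ?_
      simpa [block, blocks] using hx'
  subst hij
  have h1 := congrArg List.length hw
  have h2 := congrArg List.length hx
  have h3 := List.length_pos_iff.2 hne
  simp only [List.length_append] at h1 h2 h3
  omega

end Shrink

theorem not_isContextFree_powLanguage {n : ℕ} (hn : 3 ≤ n) : ¬ (powLanguage n).IsContextFree := by
  rintro ⟨g, hg⟩
  obtain ⟨p, hp⟩ := g.exists_shrinks
  rw [hg] at hp
  obtain h | ⟨u, v, x, y, z, hw, hne, hlen, hx⟩ :=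
    hp (blocks (List.replicate n (p + 1))) (mem_powLanguage.2 ⟨p + 1, by omega, rfl⟩)
  · rw [length_blocks_replicate] at h
    nlinarith
  · obtain ⟨j, -, hj⟩ := mem_powLanguage.1 hx
    exact shrink_ne_blocks (f := id) (s := []) (i := p + 1) (j := j) Function.injective_id hn
      (by simpa using hw) (by omega) hne (by simpa using hj)

/-- In a word representing the identity, each letter occurs a multiple of `n` times. -/
theorem dvd_count_of_piEval_eq_one {n : ℕ} {w : List Letter} (h : piEval n w = 1) (y : Letter) :
    n ∣ w.count y := by
  let f : Letter → Multiplicative (ZMod n) := fun x => .ofAdd (if x = y then 1 else 0)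
  have hf : ∀ m : Multiplicative (ZMod n), m ^ n = 1 := fun m =>
    Multiplicative.toAdd.injective (by simp [toAdd_pow])
  have H := congrArg (piLift f fun i _ => hf _) h
  rw [piLift_piEval, map_one] at H
  have hprod : ∀ w : List Letter, (w.map f).prod = .ofAdd ((w.count y : ℕ) : ZMod n) := by
    intro w
    induction w with
    | nil => simp
    | cons x w ih =>
      rw [List.map_cons, List.prod_cons, ih, List.count_cons, ← ofAdd_add]
      by_cases hx : x = y <;> simp [hx, add_comm]
  rw [hprod] at H
  exact (ZMod.natCast_eq_zero_iff _ _).1 H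

theorem count_blocks {y : Letter} (hy : y ≠ .b) (l : List ℕ) :
    (blocks l).count y = l.length := by
  induction l with
  | nil => rfl
  | cons i l ih =>
    rw [blocks_cons, List.count_append, ih, block]
    cases y <;> simp_all [List.count_append, List.count_replicate, add_comm]

/-- A subword of a product of blocks that keeps all letters `a` and `c` is again a product of
blocks. -/
theorem exists_blocks_of_sublist {l : List ℕ} {s : List Letter} (hs : s.Sublist (blocks l))
    (ha : s.count .a = l.length) (hc : s.count .c = l.length) :
    ∃ l' : List ℕ, l'.length = l.length ∧ s = blocks l' := by
  induction l generalizing s with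
  | nil => exact ⟨[], rfl, by simpa [blocks] using hs⟩
  | cons i l ih =>
    rw [blocks_cons, List.sublist_append_iff] at hs
    obtain ⟨s₁, s₂, rfl, h₁, h₂⟩ := hs
    have hbound : ∀ y : Letter, y ≠ .b → s₁.count y ≤ 1 ∧ s₂.count y ≤ l.length := by
      intro y hy
      have e₁ := h₁.count_le y
      have e₂ := h₂.count_le y
      rw [count_blocks hy] at e₂
      have := count_blocks hy [i]
      simp only [blocks, List.map_cons, List.map_nil, List.flatten_cons, List.flatten_nil,
        List.append_nil, List.length_singleton] at this
      omega
    have hba := hbound .a (by simp)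
    have hbc := hbound .c (by simp)
    rw [List.count_append, List.length_cons] at ha hc
    obtain ⟨l', hl', rfl⟩ := ih h₂ (by omega) (by omega)
    have ha₁ : s₁.count .a = 1 := by omega
    have hc₁ : s₁.count .c = 1 := by omega
    have : ∃ k, s₁ = block k := by
      rw [block, ← List.singleton_append, List.sublist_append_iff] at h₁
      obtain ⟨p, q, rfl, hp, hq⟩ := h₁
      rw [List.sublist_append_iff] at hq
      obtain ⟨q, r, rfl, hq, hr⟩ := hq
      obtain ⟨k, -, rfl⟩ := List.sublist_replicate_iff.1 hq
      rw [List.sublist_singleton] at hp hr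
      refine ⟨k, ?_⟩
      rcases hp with rfl | rfl <;> rcases hr with rfl | rfl <;>
        simp [List.count_replicate, block] at ha₁ hc₁ ⊢
    obtain ⟨k, rfl⟩ := this
    exact ⟨k :: l', by simp [hl'], (blocks_cons _ _).symm⟩

/-- Pump down the word `(a bⁱ c)ⁿ #`. One block survives, so the shortened word has a letter `a`
and a letter `c`; by divisibility it has `n` of each, so it lies in `(a b* c)ⁿ #`, and since it
represents the identity its exponents are equal. -/
theorem not_isContextFree_piWordProblem {n : ℕ} (hn : 3 ≤ n) :
    ¬ (piWordProblem n).IsContextFree := by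
  rintro ⟨g, hg⟩
  obtain ⟨p, hp⟩ := g.exists_shrinks
  rw [hg] at hp
  obtain h | ⟨u, v, x, y, z, hw, hne, hlen, hx⟩ :=
    hp ((blocks (List.replicate n (p + 1))).map some ++ [none])
      (mem_piWordProblem_append_none.2 (piEval_blocks_replicate n (by omega)))
  · rw [List.length_append, List.length_map, length_blocks_replicate] at h
    nlinarith
  -- The shortened word still has a separator, hence ends with it.
  have hsub : (u ++ x ++ z).Sublist ((blocks (List.replicate n (p + 1))).map some ++ [none]) := by
    rw [hw]
    refine List.Sublist.append (List.Sublist.trans ?_ (List.sublist_append_left _ y))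
      (List.Sublist.refl z)
    exact List.Sublist.append (List.sublist_append_left _ _) (List.Sublist.refl x)
  obtain ⟨s', t, hst, hs', ht⟩ := List.sublist_append_iff.1 hsub
  obtain ⟨s, hs, rfl⟩ := List.sublist_map_iff.1 hs'
  have hnone : none ∈ u ++ x ++ z := by
    obtain ⟨u', v', -, H⟩ := hx
    simp [H]
  obtain rfl | rfl := List.sublist_singleton.1 ht
  · rw [hst] at hnone
    simp at hnone
  rw [hst, mem_piWordProblem_append_none] at hx
  have hkeep : (block (p + 1)).map some ⊆ u ++ x ++ z := by
    obtain h | h := block_prefix_or_suffix hn hw (by omega)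
    · exact fun q hq => by simp [h.subset hq]
    · exact fun q hq => by simp [h.subset (List.mem_append_left _ hq)]
  have hcount : ∀ q : Letter, q ≠ .b → q ∈ block (p + 1) → s.count q = n := by
    intro q hq hmem
    have h1 := hs.count_le q
    rw [count_blocks hq, List.length_replicate] at h1
    have h2 : q ∈ s := by
      have := hkeep (List.mem_map_of_mem hmem)
      rw [hst] at this
      simpa using this
    exact le_antisymm h1
      (Nat.le_of_dvd (List.count_pos_iff.2 h2) (dvd_count_of_piEval_eq_one hx q))
  obtain ⟨l, hl, rfl⟩ := exists_blocks_of_sublist hs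
    (by rw [List.length_replicate]; exact hcount .a (by simp) (by simp [block]))
    (by rw [List.length_replicate]; exact hcount .c (by simp) (by simp [block]))
  rw [List.length_replicate] at hl
  obtain ⟨j, -, rfl⟩ := eq_replicate_of_piEval_blocks hl hx
  exact shrink_ne_blocks (Option.some_injective _) hn hw (by omega) hne hst

/-! ### The group of units -/

section Units

variable {n : ℕ}

/-- The free product of countably many cyclic groups of order `n`. -/
abbrev CyclicFreeProduct (n : ℕ) : Type := Monoid.CoprodI (fun _ : ℕ => Multiplicative (ZMod n))

/-- The action of the block `a bⁱ c` on the free product: right multiplication by a generator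
of the factor of index `i - 1`. -/
def mulGenerator (n : ℕ) (i : ℕ) (g : CyclicFreeProduct n) : CyclicFreeProduct n :=
  g * Monoid.CoprodI.of (i := i - 1) (.ofAdd (1 : ZMod n))

theorem iterate_mulGenerator (k i : ℕ) (g : CyclicFreeProduct n) :
    (mulGenerator n i)^[k] g = g * Monoid.CoprodI.of (i := i - 1) (.ofAdd (k : ZMod n)) := by
  induction k generalizing g with
  | zero => simp
  | succ k ih =>
    rw [Function.iterate_succ_apply, ih, mulGenerator, mul_assoc, ← map_mul, ← ofAdd_add,
      Nat.cast_succ, add_comm]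

theorem iterate_mulGenerator_self (i : ℕ) (g : CyclicFreeProduct n) :
    (mulGenerator n i)^[n] g = g := by
  rw [iterate_mulGenerator, ZMod.natCast_self, ofAdd_zero, map_one, mul_one]

variable [NeZero n]

/-- The invertible element `a bⁱ c` of `Πₙ`, for `i ≥ 1`. -/
def blockUnit (n : ℕ) [NeZero n] (i : ℕ) (hi : 1 ≤ i) : (PiMonoid n)ˣ :=
  Units.ofPowEqOne (piEval n (block i)) n
    (by rw [piEval, prod_map_block, of_relation n hi]) (NeZero.ne n)

/-- The homomorphism from the free product of cyclic groups to the units of `Πₙ` that maps the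
generator of the factor of index `i` to `a bⁱ⁺¹ c`. -/
def freeProductToUnits (n : ℕ) [NeZero n] : CyclicFreeProduct n →* (PiMonoid n)ˣ :=
  Monoid.CoprodI.lift fun i => AddMonoidHom.toMultiplicativeLeft <|
    ZMod.lift n ⟨zmultiplesHom _ (.ofMul (blockUnit n (i + 1) (by omega))), by
      rw [zmultiplesHom_apply, natCast_zsmul, ← ofMul_pow, blockUnit,
        Units.pow_ofPowEqOne, ofMul_one]⟩

theorem freeProductToUnits_of_natCast (i k : ℕ) :
    freeProductToUnits n (Monoid.CoprodI.of (i := i) (.ofAdd (k : ZMod n))) =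
      blockUnit n (i + 1) (by omega) ^ k := by
  rw [freeProductToUnits, Monoid.CoprodI.lift_of]
  have : ((k : ℤ) : ZMod n) = k := by simp
  rw [← this]
  change Additive.toMul (ZMod.lift n _ ((k : ℤ) : ZMod n)) = _
  rw [ZMod.lift_coe, zmultiplesHom_apply, natCast_zsmul, toMul_nsmul, toMul_ofMul]

/-- Elements of the free product are represented by words acting on the top of the stack by
right multiplication. -/
theorem exists_word_freeProductToUnits (g : CyclicFreeProduct n) :
    ∃ w, piEval n w = freeProductToUnits n g ∧
      ∀ s : StackState (CyclicFreeProduct n),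
        stackRun 1 (mulGenerator n) s w = (s.1 * g, s.2) := by
  induction g using Monoid.CoprodI.induction_on with
  | one => exact ⟨[], by simp [piEval_nil], fun s => by simp [stackRun]⟩
  | of i m =>
    obtain ⟨k, rfl⟩ : ∃ k : ℕ, Multiplicative.ofAdd (k : ZMod n) = m :=
      ⟨m.toAdd.val, by rw [ZMod.natCast_zmod_val]; rfl⟩
    refine ⟨blocks (List.replicate k (i + 1)), ?_, fun s => ?_⟩
    · rw [freeProductToUnits_of_natCast, piEval, prod_map_blocks, List.map_replicate,
        List.prod_replicate, Units.val_pow_eq_pow_val, ← prod_map_block]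
      rfl
    · rw [stackRun_blocks _ _ _ fun j hj => by rw [List.eq_of_mem_replicate hj]; omega]
      congr 1
      rw [← Nat.add_sub_cancel i 1, ← iterate_mulGenerator, Nat.add_sub_cancel]
      generalize s.1 = x
      induction k generalizing x with
      | zero => rfl
      | succ k ih => rw [List.replicate_succ, List.foldl_cons, ih, Function.iterate_succ_apply]
  | mul g h ihg ihh =>
    obtain ⟨u, hu, hu'⟩ := ihg
    obtain ⟨v, hv, hv'⟩ := ihh
    exact ⟨u ++ v, by rw [piEval_append, hu, hv, map_mul, Units.val_mul],
      fun s => by rw [stackRun_append, hu', hv', mul_assoc]⟩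

theorem freeProductToUnits_injective : Function.Injective (freeProductToUnits n) := by
  intro g g' h
  obtain ⟨w, hw, hw'⟩ := exists_word_freeProductToUnits g
  obtain ⟨v, hv, hv'⟩ := exists_word_freeProductToUnits g'
  have := stackRun_congr 1 (mulGenerator n) (fun i _ => iterate_mulGenerator_self i) (1, [])
    (hw.trans ((congrArg Units.val h).trans hv.symm))
  rw [hw', hv'] at this
  simpa using this

/-- The stack obtained by pushing a word spells the element represented by that word. -/
theorem stateVal_stackRun (s : StackState (CyclicFreeProduct n)) (w : List Letter) :
    stateVal (fun g => (freeProductToUnits n g : PiMonoid n)) (PresentedMonoid.of (PiRel n))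
        (stackRun 1 (mulGenerator n) s w) =
      stateVal (fun g => (freeProductToUnits n g : PiMonoid n)) (PresentedMonoid.of (PiRel n)) s *
        piEval n w := by
  induction w generalizing s with
  | nil => rw [piEval_nil, mul_one]; rfl
  | cons y w ih =>
    rw [stackRun_cons, ih, piEval_cons, ← mul_assoc]
    congr 1
    cases y with
    | a => simp [stackStep, stateVal, stackVal]
    | b => simp [stackStep, stateVal, stackVal]
    | c =>
      obtain ⟨i, h, l, hi, rfl, H⟩ | H := stackStep_c_cases 1 (mulGenerator n) s
      · obtain ⟨i, rfl⟩ : ∃ j, i = j + 1 := ⟨i - 1, by omega⟩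
        rw [H, stateVal_open_mul, stateVal, mulGenerator, map_mul, Units.val_mul]
        have := freeProductToUnits_of_natCast (n := n) i 1
        rw [Nat.cast_one, pow_one] at this
        rw [Nat.add_sub_cancel, this, blockUnit, Units.val_ofPowEqOne, piEval, prod_map_block]
        simp
      · simp [H, stateVal, stackVal]

/-- If pushing a word for a unit leaves letters on the stack, the topmost one must be `c`, since
otherwise the unit has no left inverse; but a letter `c` on the stack precludes a right inverse. -/
theorem freeProductToUnits_surjective : Function.Surjective (freeProductToUnits n) := by
  intro u
  have hcongr := fun {v w : List Letter} => stackRun_congr (n := n) (u := v) (v := w) 1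
    (mulGenerator n) fun i _ => iterate_mulGenerator_self i
  obtain ⟨w, hw⟩ := exists_piEval (u : PiMonoid n)
  obtain ⟨w', hw'⟩ := exists_piEval (↑u⁻¹ : PiMonoid n)
  have hval := stateVal_stackRun (n := n) (1, []) w
  rw [hw] at hval
  rcases hs : stackRun 1 (mulGenerator n) (1, []) w with ⟨g, _ | ⟨⟨y, x⟩, l⟩⟩
  · refine ⟨g, Units.ext ?_⟩
    rw [hs] at hval
    simpa [stateVal, stackVal] using hval
  exfalso
  by_cases hy : y = .c
  · have H := hcongr (v := w ++ w') (w := []) (s := (1, []))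
      (by rw [piEval_append, hw, hw', Units.mul_inv, piEval_nil])
    obtain ⟨z, hz⟩ := exists_c_mem_stackRun 1 (mulGenerator n)
      (s := (g, (y, x) :: l)) ⟨x, by simp [hy]⟩ w'
    rw [← hs, ← stackRun_append, H] at hz
    simp [stackRun] at hz
  · rw [hs] at hval
    obtain ⟨v, hv⟩ := exists_piEval (stackVal (fun g => (freeProductToUnits n g : PiMonoid n))
      (PresentedMonoid.of (PiRel n)) l * (freeProductToUnits n x : PiMonoid n))
    obtain ⟨q, hq, hq'⟩ := exists_word_freeProductToUnits g
    have hu : piEval n (v ++ ([y] ++ q)) = u := by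
      rw [piEval_append, piEval_append, hv, hq, piEval_cons, piEval_nil, mul_one, ← mul_assoc]
      simpa [stateVal, stackVal] using hval
    have H := hcongr (v := w' ++ (v ++ ([y] ++ q))) (w := []) (s := (1, []))
      (by rw [piEval_append, hu, hw', Units.inv_mul, piEval_nil])
    rw [stackRun_append, stackRun_append, stackRun_append, hq'] at H
    have H2 := congrArg Prod.snd H
    cases y with
    | a => simp [stackRun, stackStep] at H2
    | b => simp [stackRun, stackStep] at H2
    | c => exact hy rfl

theorem nonempty_units_mulEquiv :
    Nonempty ((PiMonoid n)ˣ ≃* Monoid.CoprodI (fun _ : ℕ => Multiplicative (ZMod n))) :=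
  ⟨(MulEquiv.ofBijective (freeProductToUnits n)
    ⟨freeProductToUnits_injective, freeProductToUnits_surjective⟩).symm⟩

end Units

/-! ### Normal forms for `n ≤ 2` -/

/-- The block `a bⁱ c` as an element of the free monoid. -/
abbrev freeBlock (i : ℕ) : FreeMonoid Letter :=
  FreeMonoid.of .a * FreeMonoid.of .b ^ i * FreeMonoid.of .c

theorem singleton_mul_singleton {α : Type*} (u v : List α) :
    ({u} * {v} : Language α) = {u ++ v} := Set.image2_singleton

/-- For a language `I`, the homomorphism sending `y₁ ⋯ yₖ` to the language `y₁ I ⋯ yₖ I`. -/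
def interleave {α : Type*} (I : Language α) : FreeMonoid α →* Language α :=
  FreeMonoid.lift fun y => {[y]} * I

theorem interleave_of {α : Type*} (I : Language α) (y : α) :
    interleave I (FreeMonoid.of y) = {[y]} * I := FreeMonoid.lift_eval_of _ _

/-- The closure properties of the set of words representing the identity of `Πₙ` that are used
to put words into normal form. -/
structure IsRelatorClosed (n : ℕ) (I : Language Letter) : Prop where
  one_le : 1 ≤ I
  mul_le : I * I ≤ I
  relator_le : ∀ i, 1 ≤ i → interleave I (powWord n i) ≤ I

theorem IsRelatorClosed.interleave_mul_le {n : ℕ} {I : Language Letter} (hI : IsRelatorClosed n I)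
    (w : FreeMonoid Letter) : I * interleave I w * I ≤ I * interleave I w := by
  induction w using FreeMonoid.inductionOn' with
  | one => simpa using hI.mul_le
  | of_mul y w ih =>
    rw [map_mul, interleave_of]
    calc I * ({[y]} * I * interleave I w) * I = I * {[y]} * (I * interleave I w * I) := by
          simp only [mul_assoc]
      _ ≤ I * {[y]} * (I * interleave I w) := by gcongr
      _ = _ := by simp only [mul_assoc]

theorem IsRelatorClosed.interleave_mul_powWord_le {n : ℕ} {I : Language Letter}
    (hI : IsRelatorClosed n I) (w : FreeMonoid Letter) {i : ℕ} (hi : 1 ≤ i) :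
    I * interleave I (w * powWord n i) ≤ I * interleave I w := by
  rw [map_mul, ← mul_assoc]
  exact le_trans (by gcongr; exact hI.relator_le i hi) (hI.interleave_mul_le w)

/-- A set `X` on which blocks act as in the stack model, together with a word spelling each
element, such that acting by a block appends it to the word and possibly deletes a relator. -/
structure SpelledModel (n : ℕ) (X : Type*) where
  /-- The base point. -/
  base : X
  /-- The action of the block `a bⁱ c`. -/
  act : ℕ → X → X
  /-- The word spelling an element. -/
  spell : X → FreeMonoid Letter
  spell_base : spell base = 1
  iterate_act : ∀ i, 1 ≤ i → ∀ x, (act i)^[n] x = x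
  spell_act : ∀ i, 1 ≤ i → ∀ x, spell x * freeBlock i = spell (act i x) ∨
    spell x * freeBlock i = spell (act i x) * powWord n i

/-- The normal form of a word in a given model. -/
noncomputable def SpelledModel.normalForm {n : ℕ} {X : Type*} (S : SpelledModel n X)
    (w : List Letter) : FreeMonoid Letter :=
  stateVal S.spell FreeMonoid.of (stackRun S.base S.act (S.base, []) w)

theorem SpelledModel.normalForm_congr {n : ℕ} {X : Type*} (S : SpelledModel n X)
    {u v : List Letter} (h : piEval n u = piEval n v) : S.normalForm u = S.normalForm v := by
  rw [normalForm, stackRun_congr S.base S.act S.iterate_act _ h, normalForm]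

/-- A word with normal form `y₁ ⋯ yₖ` lies in `I y₁ I ⋯ yₖ I`. -/
theorem SpelledModel.mem_interleave_normalForm {n : ℕ} {X : Type*} (S : SpelledModel n X)
    {I : Language Letter} (hI : IsRelatorClosed n I) (w : List Letter) :
    w ∈ I * interleave I (S.normalForm w) := by
  set K : StackState X → Language Letter :=
    fun s => I * interleave I (stateVal S.spell FreeMonoid.of s) with hK
  have hpush : ∀ (y : Letter) (m : FreeMonoid Letter),
      I * interleave I m * {[y]} ≤ I * interleave I (m * FreeMonoid.of y) := by
    intro y m
    rw [map_mul, interleave_of, ← mul_assoc, ← mul_assoc]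
    exact le_mul_of_one_le_right' hI.one_le
  have hstep : ∀ (y : Letter) (s : StackState X),
      K s * {[y]} ≤ K (stackStep S.base S.act y s) := by
    intro y s
    refine (hpush y _).trans ?_
    cases y with
    | a => simp [hK, stackStep, stateVal, stackVal, S.spell_base]
    | b => simp [hK, stackStep, stateVal, stackVal, S.spell_base]
    | c =>
      obtain ⟨i, h, l, hi, rfl, H⟩ | H := stackStep_c_cases S.base S.act s
      · rw [H, stateVal_open_mul]
        simp only [hK, S.spell_base, mul_one]
        rw [stateVal]
        obtain H' | H' := S.spell_act i hi h
        · rw [H']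
        · rw [H', ← mul_assoc]
          exact hI.interleave_mul_powWord_le _ hi
      · simp [hK, H, stateVal, stackVal, S.spell_base]
  have hrun : ∀ (w : List Letter) (s : StackState X),
      K s * {w} ≤ K (stackRun S.base S.act s w) := by
    intro w
    induction w with
    | nil => intro s; exact (mul_one (K s)).le
    | cons y w ih =>
      intro s
      rw [← List.singleton_append, ← singleton_mul_singleton, ← mul_assoc, List.singleton_append,
        stackRun_cons]
      exact le_trans (by gcongr; exact hstep y s) (ih _)
  refine hrun w (S.base, []) ?_
  have h1 : [] ∈ K (S.base, []) := by
    simp only [hK, stateVal, stackVal, S.spell_base, map_one, mul_one]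
    exact hI.one_le Language.nil_mem_one
  exact Language.append_mem_mul h1 (Set.mem_singleton w)

/-- Without relations, nothing is ever deleted. -/
def freeModel : SpelledModel 0 (FreeMonoid Letter) where
  base := 1
  act i x := x * freeBlock i
  spell := id
  spell_base := rfl
  iterate_act _ _ _ := rfl
  spell_act _ _ _ := .inl rfl

/-- For `n = 1`, every block is deleted at once. -/
def trivialModel : SpelledModel 1 Unit where
  base := ()
  act _ x := x
  spell _ := 1
  spell_base := rfl
  iterate_act _ _ _ := rfl
  spell_act _ _ _ := .inr rfl

/-- Sequences of exponents without equal neighbours: the reduced words of the free product of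
cyclic groups of order two. -/
abbrev ReducedList : Type := {l : List ℕ // l.IsChain (· ≠ ·)}

/-- Right multiplication by an involution; the last syllable is the head of the list. -/
def ReducedList.act (i : ℕ) : ReducedList → ReducedList
  | ⟨[], _⟩ => ⟨[i], .singleton i⟩
  | ⟨j :: l, h⟩ => if hij : i = j then ⟨l, h.tail⟩ else ⟨i :: j :: l, .cons_cons hij h⟩

/-- The product of blocks attached to a reduced list. -/
def ReducedList.spell (l : ReducedList) : FreeMonoid Letter := (l.1.reverse.map freeBlock).prod

theorem ReducedList.act_act (i : ℕ) (l : ReducedList) : act i (act i l) = l := by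
  obtain ⟨_ | ⟨j, l⟩, h⟩ := l
  · simp [act]
  · by_cases hij : i = j
    · subst hij
      cases l with
      | nil => simp [act]
      | cons k l =>
        have : i ≠ k := (List.isChain_cons_cons.1 h).1
        simp [act, this]
    · simp [act, hij]

/-- For `n = 2`, a block is deleted together with an equal preceding block. -/
def involutionModel : SpelledModel 2 ReducedList where
  base := ⟨[], .nil⟩
  act := ReducedList.act
  spell := ReducedList.spell
  spell_base := rfl
  iterate_act i _ l := ReducedList.act_act i l
  spell_act i _ l := by
    obtain ⟨_ | ⟨j, l⟩, h⟩ := l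
    · left
      simp [ReducedList.act, ReducedList.spell]
    · by_cases hij : i = j
      · right
        simp [ReducedList.act, ReducedList.spell, hij, powWord, pow_two, mul_assoc]
      · left
        simp [ReducedList.act, ReducedList.spell, hij, mul_assoc]

/-- For `n ≤ 2` there is a normal form `y₁ ⋯ yₖ` invariant under equality in `Πₙ`, such that
each word arises from its normal form by inserting words representing the identity. -/
theorem exists_normalForm {n : ℕ} (hn : n ≤ 2) : ∃ nf : List Letter → FreeMonoid Letter,
    (∀ u v, piEval n u = piEval n v → nf u = nf v) ∧
      ∀ I, IsRelatorClosed n I → ∀ w, w ∈ I * interleave I (nf w) := by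
  have key : ∀ {X : Type} (S : SpelledModel n X), ∃ nf : List Letter → FreeMonoid Letter,
      (∀ u v, piEval n u = piEval n v → nf u = nf v) ∧
        ∀ I, IsRelatorClosed n I → ∀ w, w ∈ I * interleave I (nf w) := fun S =>
    ⟨S.normalForm, fun _ _ => S.normalForm_congr, fun _ hI => S.mem_interleave_normalForm hI⟩
  interval_cases n
  exacts [key freeModel, key trivialModel, key involutionModel]

/-! ### Grammars for `n ≤ 2` -/

section RelatorRules

variable {T N : Type*}

/-- Rules by which the nonterminal `A` generates `(p bⁱ q)ⁿ` for all `i ≥ 1`, where `p`, `b`, `q` are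
given sentential forms. The nonterminal `M` generates `bᵏ` if `n = 1`, and `bᵏ q p bᵏ` if `n = 2`,
for all `k ≥ 0`. Only the values `n ≤ 2` are meaningful. -/
def relatorRules (A M : N) (p b q : List (Symbol T N)) : ℕ → List (ContextFreeRule T N)
  | 0 => [⟨A, []⟩]
  | 1 => [⟨A, p ++ b ++ [.nonterminal M] ++ q⟩, ⟨M, []⟩, ⟨M, b ++ [.nonterminal M]⟩]
  | _ => [⟨A, p ++ b ++ [.nonterminal M] ++ b ++ q⟩, ⟨M, q ++ p⟩, ⟨M, b ++ [.nonterminal M] ++ b⟩]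

open ContextFreeGrammar

theorem formLanguage_singleton (V : N → Language T) (A : N) :
    formLanguage V [.nonterminal A] = V A := by simp [formLanguage]

theorem relator_le_of_rules {V : N → Language T} {A M : N} {p b q : List (Symbol T N)} {n : ℕ}
    (hn : n ≤ 2) (hV : ∀ r ∈ relatorRules A M p b q n, formLanguage V r.output ≤ V r.input)
    {i : ℕ} (hi : 1 ≤ i) :
    (formLanguage V p * formLanguage V b ^ i * formLanguage V q) ^ n ≤ V A := by
  obtain ⟨k, rfl⟩ : ∃ k, i = k + 1 := ⟨i - 1, by omega⟩
  generalize hP : formLanguage V p = P at *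
  generalize hB : formLanguage V b = B at *
  generalize hQ : formLanguage V q = Q at *
  interval_cases n
  · simpa [relatorRules, formLanguage] using hV
  · simp only [relatorRules, List.forall_mem_cons, formLanguage_append, formLanguage_singleton,
      hP, hB, hQ] at hV
    obtain ⟨hA, hM, hbM, -⟩ := hV
    have hk : B ^ k ≤ V M := by
      induction k with
      | zero => simpa [formLanguage] using hM
      | succ k ih =>
        rw [pow_succ']
        exact le_trans (by gcongr; exact ih (by omega)) hbM
    rw [pow_one, pow_succ', ← mul_assoc]
    exact le_trans (by gcongr) hA
  · simp only [relatorRules, List.forall_mem_cons, formLanguage_append, formLanguage_singleton,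
      hP, hB, hQ] at hV
    obtain ⟨hA, hM, hbM, -⟩ := hV
    have hk : B ^ k * (Q * P) * B ^ k ≤ V M := by
      clear hi
      induction k with
      | zero => simpa using hM
      | succ k ih =>
        calc B ^ (k + 1) * (Q * P) * B ^ (k + 1) = B * (B ^ k * (Q * P) * B ^ k) * B := by
              conv_lhs => rw [pow_succ' B k]
              conv_lhs => enter [2]; rw [← pow_succ', pow_succ]
              simp only [mul_assoc]
          _ ≤ B * V M * B := by gcongr
          _ ≤ V M := hbM
    calc (P * B ^ (k + 1) * Q) ^ 2 = P * B * (B ^ k * (Q * P) * B ^ k) * B * Q := by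
          rw [pow_two]
          conv_lhs => enter [1]; rw [pow_succ']
          conv_lhs => enter [2]; rw [pow_succ]
          simp only [mul_assoc]
      _ ≤ P * B * V M * B * Q := by gcongr
      _ ≤ V A := hA

/-- The values taken by the words generated by the auxiliary nonterminal of `relatorRules`. -/
def middleValue {R : Type*} [Monoid R] (p b q : R) : ℕ → ℕ → R
  | 1, k => b ^ k
  | _, k => b ^ k * (q * p) * b ^ k

/-- Soundness of `relatorRules`: let `L m` be languages of words with value `m` in a monoid. If the
forms `p`, `b`, `q` have values `x`, `y`, `z`, and `V A` contains all words with value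
`(x yⁱ z)ⁿ`, then the rules are valid. -/
theorem formLanguage_relatorRules_le {R : Type*} [Monoid R] (L : R → Language T)
    (hone : 1 ≤ L 1) (hmul : ∀ m m', L m * L m' ≤ L (m * m')) {x y z : R} {V : N → Language T}
    {A M : N} {p b q : List (Symbol T N)} {n : ℕ} (hn : n ≤ 2)
    (hp : formLanguage V p ≤ L x) (hb : formLanguage V b ≤ L y) (hq : formLanguage V q ≤ L z)
    (hM : V M = ⨆ k, L (middleValue x y z n k))
    (hA : ∀ i, 1 ≤ i → L ((x * y ^ i * z) ^ n) ≤ V A) :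
    ∀ r ∈ relatorRules A M p b q n, formLanguage V r.output ≤ V r.input := by
  have hmul' : ∀ {X Y : Language T} {m m' : R}, X ≤ L m → Y ≤ L m' → X * Y ≤ L (m * m') :=
    fun h h' => (mul_le_mul' h h').trans (hmul _ _)
  interval_cases n
  · simp only [relatorRules, List.forall_mem_singleton, formLanguage]
    exact hone.trans (by simpa using hA 1 le_rfl)
  · simp only [relatorRules, List.forall_mem_cons, formLanguage_append, formLanguage_singleton, hM,
      Language.mul_iSup, Language.iSup_mul, iSup_le_iff, middleValue]
    refine ⟨fun k => ?_, ?_, fun k => ?_, by simp⟩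
    · refine (hmul' (hmul' (hmul' hp hb) le_rfl) hq).trans ?_
      refine le_trans (le_of_eq ?_) (hA (k + 1) (by omega))
      rw [pow_one, pow_succ', mul_assoc x]
    · exact le_trans (hone.trans (by simp)) (le_iSup _ 0)
    · refine (hmul' hb le_rfl).trans ?_
      rw [← pow_succ']
      exact le_iSup (fun k => L (y ^ k)) (k + 1)
  · simp only [relatorRules, List.forall_mem_cons, formLanguage_append, formLanguage_singleton, hM,
      Language.mul_iSup, Language.iSup_mul, iSup_le_iff, middleValue]
    refine ⟨fun k => ?_, ?_, fun k => ?_, by simp⟩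
    · refine (hmul' (hmul' (hmul' (hmul' hp hb) le_rfl) hb) hq).trans ?_
      refine le_trans (le_of_eq (congrArg L ?_)) (hA (k + 1) (by omega))
      rw [pow_two]
      conv_rhs => enter [1]; rw [pow_succ']
      conv_rhs => enter [2]; rw [pow_succ]
      simp only [mul_assoc]
    · refine (hmul' hq hp).trans (le_trans (by simp) (le_iSup _ 0))
    · refine (hmul' (hmul' hb le_rfl) hb).trans ?_
      refine le_trans (le_of_eq (congrArg L ?_))
        (le_iSup (fun k => L (y ^ k * (z * x) * y ^ k)) (k + 1))
      conv_rhs => enter [1]; rw [pow_succ']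
      conv_rhs => enter [2]; rw [pow_succ]
      simp only [mul_assoc]

end RelatorRules

open ContextFreeGrammar in
theorem isContextFree_powLanguage {n : ℕ} (hn : n ≤ 2) : (powLanguage n).IsContextFree := by
  set g : ContextFreeGrammar Letter := ofRules false
    (relatorRules false true [.terminal .a] [.terminal .b] [.terminal .c] n)
  have hsingle : ∀ (V : Bool → Language Letter) (y : Letter),
      formLanguage V [.terminal y] = {[y]} := by simp [formLanguage]
  let L : FreeMonoid Letter → Language Letter := fun m => {FreeMonoid.toList m}
  have hL : ∀ m m', L m * L m' = L (m * m') := fun m m' =>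
    singleton_mul_singleton _ _
  have hpow : ∀ i, L (powWord n i) = ({[.a]} * {[.b]} ^ i * {[.c]}) ^ n := by
    intro i
    let Lhom : FreeMonoid Letter →* Language Letter :=
      { toFun := L, map_one' := rfl, map_mul' := fun m m' => (hL m m').symm }
    change Lhom (powWord n i) = _
    rw [powWord, map_pow, map_mul, map_mul, map_pow]
    rfl
  refine ⟨g, le_antisymm ?_ ?_⟩
  · let V : Bool → Language Letter := fun s => if s then
      ⨆ k, L (middleValue (FreeMonoid.of .a) (FreeMonoid.of .b) (FreeMonoid.of .c) n k)
      else powLanguage n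
    refine languageFrom_le (g := g) (V := V) (fun r hr => ?_) false
    refine formLanguage_relatorRules_le L le_rfl (fun m m' => (hL m m').le) hn
      (hsingle V _).le (hsingle V _).le (hsingle V _).le rfl (fun i hi => ?_) r
      (mem_rules_ofRules.1 hr)
    rintro _ rfl
    exact ⟨i, hi, rfl⟩
  · rintro w ⟨i, hi, rfl⟩
    have h : ({[.a]} * 1 * ({[.b]} * 1) ^ i * ({[.c]} * 1)) ^ n ≤ g.languageFrom false :=
      relator_le_of_rules (V := g.languageFrom) hn
        (fun r hr => formLanguage_le_languageFrom (mem_rules_ofRules.2 hr)) hi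
    rw [mul_one, mul_one, mul_one, ← hpow] at h
    exact h rfl

/-- Nonterminals of the grammar for the word problem: `one false` generates the words
representing the identity and `one true` their reversals; the nonterminals `mid` are auxiliary. -/
inductive PiNonterminal where
  | start
  | one (r : Bool)
  | mid (r : Bool)

section PiGrammar

open ContextFreeGrammar PiNonterminal

/-- A letter followed by a word representing the identity, or the mirror image of this. -/
def syllable (r : Bool) (y : Letter) : List (Symbol (Option Letter) PiNonterminal) :=
  if r then [.nonterminal (one r), .terminal (some y)]
  else [.terminal (some y), .nonterminal (one r)]

/-- Rules generating the words representing the identity (`r = false`) or their reversals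
(`r = true`). -/
def oneRules (n : ℕ) (r : Bool) : List (ContextFreeRule (Option Letter) PiNonterminal) :=
  ⟨one r, []⟩ :: ⟨one r, [.nonterminal (one r), .nonterminal (one r)]⟩ ::
    relatorRules (one r) (mid r) (syllable r (if r then .c else .a)) (syllable r .b)
      (syllable r (if r then .a else .c)) n

/-- Rules generating `w₀ y₁ w₁ ⋯ yₖ wₖ # wₖ' yₖ ⋯ w₁' y₁ w₀'`, where the `wⱼ` and the reversals of
the `wⱼ'` represent the identity. -/
def startRules : List (ContextFreeRule (Option Letter) PiNonterminal) :=
  ⟨start, [.nonterminal (one false), .terminal none, .nonterminal (one true)]⟩ ::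
    [Letter.a, .b, .c].map fun y => ⟨start, [.nonterminal (one false), .terminal (some y),
      .nonterminal start, .terminal (some y), .nonterminal (one true)]⟩

/-- A grammar for the word problem of `Πₙ`, when `n ≤ 2`. -/
noncomputable def piGrammar (n : ℕ) : ContextFreeGrammar (Option Letter) :=
  ofRules start (startRules ++ oneRules n false ++ oneRules n true)

section Soundness

variable {R : Type*} [Monoid R] (f : Letter → R)

/-- The words without separator that have value `m` in the monoid `R`. -/
def valueLanguage (m : R) : Language (Option Letter) :=
  {x | ∃ w : List Letter, x = w.map some ∧ (w.map f).prod = m}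

theorem one_le_valueLanguage : 1 ≤ valueLanguage f 1 := by
  rintro _ rfl
  exact ⟨[], rfl, rfl⟩

theorem valueLanguage_mul_le (m m' : R) :
    valueLanguage f m * valueLanguage f m' ≤ valueLanguage f (m * m') := by
  rintro _ ⟨_, ⟨u, rfl, rfl⟩, _, ⟨v, rfl, rfl⟩, rfl⟩
  exact ⟨u ++ v, by simp, by simp⟩

theorem singleton_le_valueLanguage (y : Letter) : {[some y]} ≤ valueLanguage f (f y) := by
  rintro _ rfl
  exact ⟨[y], rfl, by simp⟩

theorem formLanguage_oneRules_le {n : ℕ} (hn : n ≤ 2) {r : Bool}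
    {V : PiNonterminal → Language (Option Letter)} (hone : V (one r) = valueLanguage f 1)
    (hmid : V (mid r) = ⨆ k, valueLanguage f (middleValue (f (if r then .c else .a)) (f .b)
      (f (if r then .a else .c)) n k))
    (hrel : ∀ i, 1 ≤ i →
      (f (if r then .c else .a) * f .b ^ i * f (if r then .a else .c)) ^ n = 1) :
    ∀ ρ ∈ oneRules n r, formLanguage V ρ.output ≤ V ρ.input := by
  have hsyl : ∀ y, formLanguage V (syllable r y) ≤ valueLanguage f (f y) := by
    intro y
    cases r
    · simp only [syllable, formLanguage, mul_one, hone, Bool.false_eq_true, if_false]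
      have := (mul_le_mul_left (singleton_le_valueLanguage f y) _).trans
        (valueLanguage_mul_le f (f y) 1)
      rwa [mul_one] at this
    · simp only [syllable, formLanguage, mul_one, hone, if_true]
      have := (mul_le_mul_right (singleton_le_valueLanguage f y) _).trans
        (valueLanguage_mul_le f 1 (f y))
      rwa [one_mul] at this
  rw [oneRules, List.forall_mem_cons, List.forall_mem_cons]
  refine ⟨?_, ?_, ?_⟩
  · simpa [formLanguage, hone] using one_le_valueLanguage f
  · simpa [formLanguage, hone] using valueLanguage_mul_le f 1 1
  · refine formLanguage_relatorRules_le (valueLanguage f) (one_le_valueLanguage f)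
      (valueLanguage_mul_le f) hn (hsyl _) (hsyl _) (hsyl _) hmid fun i hi => ?_
    rw [hrel i hi, hone]

end Soundness

theorem prod_map_op_of (n : ℕ) (w : List Letter) :
    (w.map fun y => MulOpposite.op (PresentedMonoid.of (PiRel n) y)).prod =
      .op (piEval n w.reverse) := by
  induction w with
  | nil => rfl
  | cons y w ih =>
    rw [List.map_cons, List.prod_cons, ih, List.reverse_cons, piEval_append, MulOpposite.op_mul]
    simp [piEval]

theorem language_piGrammar_le {n : ℕ} (hn : n ≤ 2) : (piGrammar n).language ≤ piWordProblem n := by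
  set f : Letter → PiMonoid n := PresentedMonoid.of (PiRel n)
  set f' : Letter → (PiMonoid n)ᵐᵒᵖ := fun y => .op (f y)
  let V : PiNonterminal → Language (Option Letter)
    | start => piWordProblem n
    | one false => valueLanguage f 1
    | one true => valueLanguage f' 1
    | mid false => ⨆ k, valueLanguage f (middleValue (f .a) (f .b) (f .c) n k)
    | mid true => ⨆ k, valueLanguage f' (middleValue (f' .c) (f' .b) (f' .a) n k)
  refine languageFrom_le (g := piGrammar n) (V := V)
    (fun (r : ContextFreeRule (Option Letter) PiNonterminal) hr => ?_) start
  have hr' := mem_rules_ofRules.1 hr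
  rw [List.mem_append, List.mem_append] at hr'
  obtain (hr' | hr') | hr' := hr'
  · have hrev : ∀ w : List Letter, (w.map f').prod = 1 → piEval n w.reverse = 1 := by
      intro w hw
      rw [prod_map_op_of] at hw
      exact MulOpposite.op_injective hw
    rw [startRules, List.mem_cons, List.mem_map] at hr'
    obtain rfl | ⟨y, -, rfl⟩ := hr'
    · rintro _ ⟨_, ⟨u, rfl, hu⟩, _, ⟨_, rfl, _, ⟨_, ⟨v, rfl, hv⟩, _, rfl, rfl⟩, rfl⟩, rfl⟩
      exact ⟨u, v.reverse, hu.trans (hrev v hv).symm, by simp⟩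
    · rintro _ ⟨_, ⟨u, rfl, hu⟩, _, ⟨_, rfl, _, ⟨_, ⟨u', v', h, rfl⟩, _, ⟨_, rfl, _,
        ⟨_, ⟨v, rfl, hv⟩, _, rfl, rfl⟩, rfl⟩, rfl⟩, rfl⟩, rfl⟩
      refine mem_piWordProblem.2 ⟨u ++ y :: u', v.reverse ++ y :: v', ?_, by simp⟩
      have hu : piEval n u = 1 := hu
      have h : piEval n u' = piEval n v' := h
      rw [piEval_append, piEval_append, piEval_cons, piEval_cons, hu, hrev v hv, h]
  · exact formLanguage_oneRules_le f hn (r := false) rfl rfl (fun i hi => of_relation n hi) r hr'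
  · refine formLanguage_oneRules_le f' hn (r := true) rfl rfl (fun i hi => ?_) r hr'
    have := congrArg MulOpposite.op (of_relation n hi)
    simpa [f', mul_assoc] using this

/-- The words over `A` that a nonterminal of the grammar generates. -/
def lettersFrom (n : ℕ) (A : PiNonterminal) : Language Letter :=
  {w | w.map some ∈ (piGrammar n).languageFrom A}

theorem map_lettersFrom_le (n : ℕ) (A : PiNonterminal) :
    Language.map some (lettersFrom n A) ≤ (piGrammar n).languageFrom A := by
  rintro _ ⟨w, hw, rfl⟩
  exact hw

theorem le_lettersFrom_iff {n : ℕ} {A : PiNonterminal} {K : Language Letter} :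
    K ≤ lettersFrom n A ↔ Language.map some K ≤ (piGrammar n).languageFrom A := by
  constructor
  · rintro h _ ⟨w, hw, rfl⟩
    exact h hw
  · exact fun h w hw => h ⟨w, hw, rfl⟩

theorem map_singleton_some (y : Letter) :
    Language.map some ({[y]} : Language Letter) = {[some y]} := Set.image_singleton

section Completeness

variable {n : ℕ}

theorem formLanguage_le_of_mem_oneRules {r : Bool}
    {ρ : ContextFreeRule (Option Letter) PiNonterminal} (hρ : ρ ∈ oneRules n r) :
    formLanguage (piGrammar n).languageFrom ρ.output ≤ (piGrammar n).languageFrom ρ.input := by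
  refine formLanguage_le_languageFrom (g := piGrammar n) (mem_rules_ofRules.2 ?_)
  cases r <;> simp [hρ]

theorem one_le_lettersFrom (r : Bool) : 1 ≤ lettersFrom n (one r) := by
  rw [le_lettersFrom_iff, map_one]
  exact formLanguage_le_of_mem_oneRules (r := r) (ρ := ⟨one r, []⟩) (by simp [oneRules])

theorem lettersFrom_mul_le (r : Bool) :
    lettersFrom n (one r) * lettersFrom n (one r) ≤ lettersFrom n (one r) := by
  rw [le_lettersFrom_iff, map_mul]
  refine (mul_le_mul' (map_lettersFrom_le _ _) (map_lettersFrom_le _ _)).trans ?_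
  have := formLanguage_le_of_mem_oneRules (n := n) (r := r)
    (ρ := ⟨one r, [.nonterminal (one r), .nonterminal (one r)]⟩) (by simp [oneRules])
  simpa [formLanguage] using this

theorem relator_le_languageFrom (hn : n ≤ 2) (r : Bool) {i : ℕ} (hi : 1 ≤ i) :
    (formLanguage (piGrammar n).languageFrom (syllable r (if r then .c else .a)) *
      formLanguage (piGrammar n).languageFrom (syllable r .b) ^ i *
      formLanguage (piGrammar n).languageFrom (syllable r (if r then .a else .c))) ^ n ≤
      (piGrammar n).languageFrom (one r) :=
  relator_le_of_rules hn (fun _ hρ => formLanguage_le_of_mem_oneRules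
    (List.mem_cons_of_mem _ (List.mem_cons_of_mem _ hρ))) hi

theorem isRelatorClosed_lettersFrom (hn : n ≤ 2) :
    IsRelatorClosed n (lettersFrom n (one false)) where
  one_le := one_le_lettersFrom false
  mul_le := lettersFrom_mul_le false
  relator_le i hi := by
    rw [le_lettersFrom_iff, powWord]
    simp only [map_pow, map_mul, interleave_of, map_singleton_some]
    refine le_trans ?_ (relator_le_languageFrom hn false hi)
    simp only [syllable, formLanguage, mul_one, Bool.false_eq_true, if_false]
    gcongr <;> exact map_lettersFrom_le _ _

theorem isRelatorClosed_reverse_lettersFrom (hn : n ≤ 2) :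
    IsRelatorClosed n (lettersFrom n (one true)).reverse where
  one_le := by
    rw [← Language.reverse_one]
    exact fun _ hw => one_le_lettersFrom true hw
  mul_le := by
    rw [← Language.reverse_mul]
    exact fun _ hw => lettersFrom_mul_le true hw
  relator_le i hi := by
    have hsing : ∀ y : Letter, ({[y]} : Language Letter).reverse = {[y]} := by
      intro y
      ext w
      exact List.reverse_eq_iff
    suffices (interleave (lettersFrom n (one true)).reverse (powWord n i)).reverse ≤
        lettersFrom n (one true) from
      fun w hw => this (Language.reverse_mem_reverse.2 hw)
    rw [le_lettersFrom_iff, powWord]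
    simp only [map_pow, map_mul, interleave_of, map_singleton_some, Language.reverse_pow,
      Language.reverse_mul, Language.reverse_reverse, hsing]
    refine le_trans ?_ (relator_le_languageFrom hn true hi)
    simp only [syllable, formLanguage, mul_one, if_true]
    rw [← mul_assoc]
    gcongr <;> exact map_lettersFrom_le _ _

/-- Two words obtained by insertions from the same normal form are matched by the grammar. -/
theorem mem_language_of_interleave (s : FreeMonoid Letter) {u v : List Letter}
    (hu : u ∈ lettersFrom n (one false) * interleave (lettersFrom n (one false)) s)
    (hv : v ∈ (lettersFrom n (one true)).reverse *
      interleave (lettersFrom n (one true)).reverse s) :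
    u.map some ++ [none] ++ v.reverse.map some ∈ (piGrammar n).languageFrom start := by
  have hrule : ∀ {ρ : ContextFreeRule (Option Letter) PiNonterminal}, ρ ∈ startRules →
      formLanguage (piGrammar n).languageFrom ρ.output ≤ (piGrammar n).languageFrom ρ.input :=
    fun hρ => formLanguage_le_languageFrom (g := piGrammar n)
      (mem_rules_ofRules.2 (by simp [hρ]))
  induction s using FreeMonoid.inductionOn' generalizing u v with
  | one =>
    rw [map_one, mul_one] at hu hv
    refine hrule (List.mem_cons_self) ⟨_, hu, _, ⟨_, rfl, _, ⟨_, hv, _, rfl, rfl⟩, rfl⟩, ?_⟩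
    simp
  | of_mul y s ih =>
    rw [map_mul, interleave_of, mul_assoc] at hu hv
    obtain ⟨u₀, hu₀, _, ⟨_, rfl, u, hu, rfl⟩, rfl⟩ := hu
    obtain ⟨v₀, hv₀, _, ⟨_, rfl, v, hv, rfl⟩, rfl⟩ := hv
    refine hrule (List.mem_cons_of_mem _ (List.mem_map_of_mem (a := y) (by cases y <;> simp)))
      ⟨_, hu₀, _, ⟨_, rfl, _, ⟨_, ih hu hv, _, ⟨_, rfl, _, ⟨_, hv₀, _, rfl, rfl⟩, rfl⟩, rfl⟩,
        rfl⟩, ?_⟩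
    simp

/-- Words equal in `Πₙ` have the same normal form, from which the grammar generates both. -/
theorem isContextFree_piWordProblem (hn : n ≤ 2) : (piWordProblem n).IsContextFree := by
  refine ⟨piGrammar n, le_antisymm (language_piGrammar_le hn) ?_⟩
  rintro _ ⟨u, v, h, rfl⟩
  obtain ⟨nf, hnf, hmem⟩ := exists_normalForm hn
  refine mem_language_of_interleave (nf u) (hmem _ (isRelatorClosed_lettersFrom hn) u) ?_
  rw [hnf u v h]
  exact hmem _ (isRelatorClosed_reverse_lettersFrom hn) v

end Completeness

end PiGrammar

theorem mainTheorem6 (n : ℕ) :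
    ((piWordProblem n).IsContextFree ↔ n ≤ 2) ∧
    ((powLanguage n).IsContextFree ↔ n ≤ 2) ∧
    piWordProblem n ⊓ regularLanguage n = Language.map some (powLanguage n) * hashLanguage ∧
    (1 ≤ n → Nonempty
      ((PiMonoid n)ˣ ≃* Monoid.CoprodI (fun _ : ℕ => Multiplicative (ZMod n)))) := by
  refine ⟨⟨fun h => ?_, isContextFree_piWordProblem⟩, ⟨fun h => ?_, isContextFree_powLanguage⟩,
    piWordProblem_inf_regularLanguage n, fun hn => ?_⟩
  · by_contra hn
    exact not_isContextFree_piWordProblem (by omega) h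
  · by_contra hn
    exact not_isContextFree_powLanguage (by omega) h
  · have : NeZero n := ⟨by omega⟩
    exact nonempty_units_mulEquiv
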